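/- Let $n \ge 2$. Let $\mathcal B_n = \{\pm 1\}^n \rtimes \mathfrak S_n$ be the group of signed permutation matrices of size $n$ (the Weyl group of type $B_n$). For $1\le i\le n$ let $t_i \in \mathcal B_n$ be the diagonal matrix with $-1$ in position $i$ and $+1$ elsewhere on the diagonal. Let $\varepsilon' : \mathcal B_n \to \{\pm 1\}$ be the linear character with $\varepsilon'(t_i) = -1$ for all $i$ and $\varepsilon'(\sigma) = 1$ for $\sigma\in\mathfrak S_n$, and let $\mathcal D_n = \ker(\varepsilon')$ (the Weyl group of type $D_n$). Let $\mathfrak b_n$ be the Lie subalgebra of $\mathbb C\mathcal B_n$ (with bracket $[x,y]=xy-yx$) generated by the reflections $(i,j)$ and $t_it_j(i,j)$ for $1\le i<j\le n$, together with the reflections $t_i$ for $1\le i\le n$. Let $\mathfrak d_n$ be the Lie subalgebra of $\mathbb C\mathcal D_n$ generated by the reflections $(i,j)$ and $t_it_j(i,j)$ for $1\le i<j\le n$. Write $\mathfrak g'=[\mathfrak g,\mathfrak g]$ for the derived subalgebra of a Lie algebra $\mathfrak g$. For a partition $\lambda\vdash n$ let $S^\lambda$ be the Specht module of $\mathbb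 C\mathfrak S_n$ labelled by $\lambda$ (so that $S^{[n]}$ is the trivial module), let $S^{(\lambda,\emptyset)}$ be its inflation along the canonical quotient map $\mathcal B_n\to\mathfrak S_n$, and let $S^{(\emptyset,\lambda)}=S^{(\lambda,\emptyset)}\otimes\varepsilon'$. Let $(G,\mathfrak g)$ be $(\mathcal B_n,\mathfrak b_n)$ or $(\mathcal D_n,\mathfrak d_n)$, and let $V_1,V_2$ be simple $\mathbb CG$-modules of dimension greater than $1$, regarded by restriction also as modules over $\mathfrak g$ and $\mathfrak g'$. Consider the statements: 1. $V_1\cong V_2$ as $\mathbb CG$-modules; 2. $V_1\cong V_2$ as $\mathfrak g$-modules; 3. $V_1\cong V_2$ as $\mathfrak g'$-modules. Then (1) and (2) are equivalent, and (2) implies (3). - If $(G,\mathfrak g)=(\mathcal D_n,\mathfrak d_n)$, then (3) implies (1), and hence all three statements are equivalent. - If $(G,\mathfrak g)=(\mathcal B_n,\mathfrak b_n)$, then (3) holds if and only if either $V_1\cong V_2$ as $\mathbb C\mathcal B_n$-modules or, up to interchanging $V_1$ and $V_2$, one has $V_1\cong S^{(\lambda,\emptyset)}$ and $V_2\cong S^{(\emptyset,\lambda)}$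 as $\mathbb C\mathcal B_n$-modules for some $\lambda\vdash n$. -/

import Mathlib

noncomputable section

namespace WeylRefl

/-! ### The Weyl groups of types B and D -/

/-- The Weyl group of type `B_n`: the group of signed permutation matrices of size `n`, written as
the semidirect product `N_n ⋊ S_n`.  The pair `⟨a, σ⟩` is the matrix `diag(a) * P_σ`, where
`P_σ e_j = e_{σ j}`, and `S_n` acts on `N_n = {±1}^n` by `(σ • a) i = a (σ⁻¹ i)`. -/
abbrev B (n : ℕ) : Type := (Fin n → ℤˣ) ⋊[mulAutArrow] Equiv.Perm (Fin n)

/-- The permutation `σ ∈ S_n` as an element of `B_n`. -/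
def perm {n : ℕ} (σ : Equiv.Perm (Fin n)) : B n := SemidirectProduct.inr σ

/-- The sign change `t_i`: the diagonal matrix with `-1` in position `i` and `1` elsewhere. -/
def t {n : ℕ} (i : Fin n) : B n := SemidirectProduct.inl (Pi.mulSingle i (-1))

/-- The linear character `ε'` of `B_n`, with `ε'(t_i) = -1` and `ε'(σ) = 1` for `σ ∈ S_n`. -/
def epsPrime (n : ℕ) : B n →* ℤˣ where
  toFun g := ∏ i, g.left i
  map_one' := by simp
  map_mul' g h := by
    have key : ∀ σ : Equiv.Perm (Fin n), ∏ i, (mulAutArrow σ h.left) i = ∏ i, h.left i := by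
      intro σ
      exact Fintype.prod_equiv σ⁻¹ _ _ (fun i => rfl)
    simp only [SemidirectProduct.mul_left, Pi.mul_apply, Finset.prod_mul_distrib, key]

/-- The Weyl group of type `D_n`, the kernel of `ε'` in `B_n`. -/
abbrev D (n : ℕ) : Subgroup (B n) := (epsPrime n).ker

/-- The elements `(i,j)` and `t_i t_j (i,j)`, for `i < j`. -/
def reflSwap (n : ℕ) : Set (B n) :=
  {g | ∃ i j : Fin n, i < j ∧ (g = perm (Equiv.swap i j) ∨ g = t i * t j * perm (Equiv.swap i j))}

/-- The set of reflections in `B_n`. -/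
def reflB (n : ℕ) : Set (B n) := reflSwap n ∪ Set.range t

/-- The set of reflections in `D_n`. -/
def reflD (n : ℕ) : Set (D n) := {g | (g : B n) ∈ reflSwap n}

/-! ### The Lie algebras generated by reflections -/

section LieAlgebras

-- `Lie(A)` has bracket `⁅x, y⁆ = x * y - y * x`, and acts on an `A`-module by `⁅x, v⁆ = x • v`.
attribute [local instance] LieRing.ofAssociativeRing LieRingModule.ofAssociativeModule

/-- The Lie subalgebra of `Lie(ℂG)` (bracket `[x, y] = x * y - y * x`) generated by a set of group
elements. -/
def lieGen {G : Type*} [Group G] (S : Set G) : LieSubalgebra ℂ (MonoidAlgebra ℂ G) :=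
  LieSubalgebra.lieSpan ℂ (MonoidAlgebra ℂ G) (MonoidAlgebra.of ℂ G '' S)

/-- The Lie algebra `𝔟_n` generated by the reflections in `B_n`. -/
def lieB (n : ℕ) : LieSubalgebra ℂ (MonoidAlgebra ℂ (B n)) := lieGen (reflB n)

/-- The Lie algebra `𝔡_n` generated by the reflections in `D_n`. -/
def lieD (n : ℕ) : LieSubalgebra ℂ (MonoidAlgebra ℂ (D n)) := lieGen (reflD n)

variable {A : Type*} [Ring A] [Algebra ℂ A] (𝔤 : LieSubalgebra ℂ A)
  (V : Type*) [AddCommGroup V] [Module ℂ V] [Module A V]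
  (W : Type*) [AddCommGroup W] [Module ℂ W] [Module A W]

/-- The `A`-modules `V` and `W` become isomorphic on restriction to the Lie subalgebra `𝔤` of
`Lie(A)`. -/
def IsoLie : Prop := Nonempty (V ≃ₗ⁅ℂ, 𝔤⁆ W)

/-- The `A`-modules `V` and `W` become isomorphic on restriction to the derived subalgebra
`𝔤' = [𝔤, 𝔤]` of the Lie subalgebra `𝔤` of `Lie(A)`. -/
def IsoDerived : Prop := Nonempty (V ≃ₗ⁅ℂ, LieAlgebra.derivedSeries ℂ 𝔤 1⁆ W)

end LieAlgebras

/-! ### Specht modules and the simple modules `S^(λ,∅)` and `S^(∅,λ)` -/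

/-- The twist `V ⊗ χ` of a representation by a linear character `χ` with values in `{±1}`, on the
same underlying space: `g` acts as `χ(g) ρ(g)`. -/
def twist {G V : Type*} [Group G] [AddCommGroup V] [Module ℂ V] (χ : G →* ℤˣ)
    (ρ : Representation ℂ G V) : Representation ℂ G V where
  toFun g := ((χ g : ℤ) : ℂ) • ρ g
  map_one' := by simp
  map_mul' a b := by
    ext v
    simp [smul_smul, mul_comm]

section Specht

variable {n : ℕ} (lam : YoungDiagram) (h : lam.card = n)

/-- A filling of the boxes of the Young diagram by `1, …, n`; the Specht module does not depend on
it up to isomorphism. -/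
def tableau : lam.cells ≃ Fin n := lam.cells.equivFinOfCardEq h

/-- The sum of the permutations that preserve every row of the tableau. -/
def rowSum : MonoidAlgebra ℂ (Equiv.Perm (Fin n)) :=
  ∑ σ : Equiv.Perm (Fin n) with
    ∀ i, ((tableau lam h).symm (σ i)).1.1 = ((tableau lam h).symm i).1.1,
    MonoidAlgebra.of ℂ _ σ

/-- The signed sum of the permutations that preserve every column of the tableau. -/
def colSum : MonoidAlgebra ℂ (Equiv.Perm (Fin n)) :=
  ∑ σ : Equiv.Perm (Fin n) with
    ∀ i, ((tableau lam h).symm (σ i)).1.2 = ((tableau lam h).symm i).1.2,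
    ((Equiv.Perm.sign σ : ℤ) : ℂ) • MonoidAlgebra.of ℂ _ σ

/-- The Specht module `S^λ`, as the left ideal of `ℂS_n` generated by `colSum * rowSum`.  Under the
identification of `ℂS_n * rowSum` with the permutation module on `λ`-tabloids, `colSum * rowSum` is
the polytabloid of the tableau. -/
def specht : Submodule (MonoidAlgebra ℂ (Equiv.Perm (Fin n)))
    (MonoidAlgebra ℂ (Equiv.Perm (Fin n))) :=
  Submodule.span _ {colSum lam h * rowSum lam h}

/-- `S^λ` as a representation of `S_n`: the action by left multiplication. -/
def spechtRep : Representation ℂ (Equiv.Perm (Fin n)) (specht lam h) :=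
  (Algebra.lsmul ℂ ℂ (specht lam h) :
      MonoidAlgebra ℂ (Equiv.Perm (Fin n)) →ₐ[ℂ] Module.End ℂ (specht lam h)).toMonoidHom.comp
    (MonoidAlgebra.of ℂ (Equiv.Perm (Fin n)))

/-- `S^(λ,∅)`: the inflation of `S^λ` along the quotient map `B_n → S_n`. -/
def repLeft : Representation ℂ (B n) (specht lam h) :=
  (spechtRep lam h).comp SemidirectProduct.rightHom

/-- `S^(∅,λ)`: the twist `S^(λ,∅) ⊗ ε'`. -/
def repRight : Representation ℂ (B n) (specht lam h) :=
  twist (epsPrime n) (repLeft lam h)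

/-- The `ℂB_n`-module `S^(λ,∅)`. -/
abbrev SLeft : Type := (repLeft lam h).asModule

/-- The `ℂB_n`-module `S^(∅,λ)`. -/
abbrev SRight : Type := (repRight lam h).asModule

end Specht

end WeylRefl

end

noncomputable section

namespace WeylRefl

/-! ### Intertwiners of Lie subalgebras of an associative algebra -/

section Restriction

attribute [local instance] LieRing.ofAssociativeRing LieRingModule.ofAssociativeModule

variable {A : Type*} [Ring A] [Algebra ℂ A] (𝔤 : LieSubalgebra ℂ A)
  (V : Type*) [AddCommGroup V] [Module ℂ V] [Module A V]
  (W : Type*) [AddCommGroup W] [Module ℂ W] [Module A W]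

/-! Statements (1) and (2) agree because the reflections generate the group and lie in the Lie
algebra; (2) implies (3) by restriction. The content is what an isomorphism `f` of modules over the
derived algebra must satisfy.

Measure `f` on a reflection `s` by its defect, `v ↦ f (s v) - s (f v)`. For involutions `k`, `s` in
the generating set, `[k, [k, s]] = 2 (s - k s k)` lies in the derived algebra, so `s` and `k s k⁻¹`
have the same defect (`defect_conj`). If all of a conjugacy class of reflections is linked in this
way, Schur's lemma for the class sum shows that the common defect is `ω f` for a scalar `ω`. From
`s² = 1` one gets `2ω (s + ω/2) = 0` on the target. So either `ω = 0` and `f` commutes with the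
class, or the class acts by opposite signs on the two modules (`commutes_or_opposite_signs`).

In `D_n` with `n ≥ 3` there is a single class and it generates, so the second alternative forces
dimension one; `D_2` is commutative. In `B_n` there are two classes. The class of the `(i,j)` cannot
act by a scalar in dimension greater than one, so `f` commutes with it. If `f` does not commute with
the `t_i`, these act as `1` on one module and `-1` on the other. The first module then comes from a
simple `S_n`-module `S^λ`, and `f` carries this structure to the other, which is the twist by `ε'`.
Conversely, a map commuting with the generators up to scalars commutes with all brackets
(`isoDerived_of_scalar_defect`).

Naming the module `S^λ` needs the classification for `S_n`: Young symmetrizers make Specht modules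
simple and pairwise non-isomorphic, and character orthogonality leaves no room for another simple
module. -/

theorem isoLie_iff :
    IsoLie 𝔤 V W ↔ ∃ f : V ≃ₗ[ℂ] W, ∀ x ∈ 𝔤, ∀ v, f (x • v) = x • f v := by
  constructor
  · rintro ⟨f⟩
    exact ⟨f.toLinearEquiv, fun x hx v => f.toLieModuleHom.map_lie (⟨x, hx⟩ : 𝔤) v⟩
  · rintro ⟨f, hf⟩
    exact ⟨{ f with map_lie' := fun {x v} => hf x x.2 v }⟩

/-- Brackets span the derived subalgebra linearly, so testing single brackets is enough. -/
theorem isoDerived_iff [IsScalarTower ℂ A V] [IsScalarTower ℂ A W] :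
    IsoDerived 𝔤 V W ↔ ∃ f : V ≃ₗ[ℂ] W, ∀ x ∈ 𝔤, ∀ y ∈ 𝔤, ∀ v,
      f ((x * y - y * x) • v) = (x * y - y * x) • f v := by
  constructor
  · rintro ⟨f⟩
    refine ⟨f.toLinearEquiv, fun x hx y hy v => ?_⟩
    have hxy : ⁅(⟨x, hx⟩ : 𝔤), (⟨y, hy⟩ : 𝔤)⁆ ∈ LieAlgebra.derivedSeries ℂ 𝔤 1 :=
      LieSubmodule.lie_mem_lie (LieSubmodule.mem_top _) (LieSubmodule.mem_top _)
    exact f.toLieModuleHom.map_lie (⟨_, hxy⟩ : LieAlgebra.derivedSeries ℂ 𝔤 1) v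
  · rintro ⟨f, hf⟩
    refine ⟨{ f with map_lie' := ?_ }⟩
    rintro ⟨x, hx⟩ v
    change f ((x : A) • v) = (x : A) • f v
    have hx' : x ∈ Submodule.span ℂ
        {m | ∃ a ∈ (⊤ : LieIdeal ℂ 𝔤), ∃ b ∈ (⊤ : LieIdeal ℂ 𝔤), ⁅a, b⁆ = m} := by
      rw [← LieSubmodule.lieIdeal_oper_eq_linear_span']
      exact hx
    clear hx
    induction hx' using Submodule.span_induction generalizing v with
    | mem x hx =>
      obtain ⟨a, -, b, -, rfl⟩ := hx
      exact hf a a.2 b b.2 v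
    | zero => simp
    | add x y _ _ hx hy =>
      change f ((x + y : A) • v) = (x + y : A) • f v
      simp only [add_smul, map_add, hx, hy]
    | smul c x _ hx =>
      change f ((c • (x : A)) • v) = (c • (x : A)) • f v
      simp only [smul_assoc, map_smul, hx]

theorem IsoLie.isoDerived [IsScalarTower ℂ A V] [IsScalarTower ℂ A W] (h : IsoLie 𝔤 V W) :
    IsoDerived 𝔤 V W := by
  rw [isoLie_iff] at h
  rw [isoDerived_iff]
  obtain ⟨f, hf⟩ := h
  exact ⟨f, fun x hx y hy v => by simp only [sub_smul, mul_smul, map_sub, hf x hx, hf y hy]⟩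

theorem IsoDerived.symm (h : IsoDerived 𝔤 V W) : IsoDerived 𝔤 W V :=
  h.map fun e => e.symm

end Restriction

/-! ### Modules over a group algebra and Schur's lemma -/

section GroupAlgebra

open MonoidAlgebra

attribute [local instance] LieRing.ofAssociativeRing

variable {G : Type*} [Group G]
  {V : Type*} [AddCommGroup V] [Module ℂ V] [Module (MonoidAlgebra ℂ G) V]
  [IsScalarTower ℂ (MonoidAlgebra ℂ G) V]
  {W : Type*} [AddCommGroup W] [Module ℂ W] [Module (MonoidAlgebra ℂ G) W]
  [IsScalarTower ℂ (MonoidAlgebra ℂ G) W]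

theorem of_mem_lieGen {S : Set G} {s : G} (hs : s ∈ S) :
    of ℂ G s ∈ lieGen S := LieSubalgebra.subset_lieSpan ⟨s, hs, rfl⟩

/-- A linear isomorphism that commutes with a generating set of `G` is an isomorphism of
`ℂG`-modules. -/
theorem nonempty_equiv_of_closure {S : Set G} (hS : Subgroup.closure S = ⊤) (f : V ≃ₗ[ℂ] W)
    (hf : ∀ s ∈ S, ∀ v, f (of ℂ G s • v) = of ℂ G s • f v) :
    ∃ e : V ≃ₗ[MonoidAlgebra ℂ G] W, ∀ v, e v = f v := by
  have hG : ∀ g : G, ∀ v, f (of ℂ G g • v) = of ℂ G g • f v := by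
    intro g
    have hg : g ∈ Subgroup.closure S := hS ▸ Subgroup.mem_top g
    induction hg using Subgroup.closure_induction with
    | mem s hs => exact hf s hs
    | one => simp only [map_one, one_smul, implies_true]
    | mul x y _ _ hx hy => intro v; simp only [map_mul, mul_smul, hx, hy]
    | inv x _ hx =>
      intro v
      have h := hx (of ℂ G x⁻¹ • v)
      rw [← mul_smul, ← map_mul, mul_inv_cancel, map_one, one_smul] at h
      rw [h, ← mul_smul, ← map_mul, inv_mul_cancel, map_one, one_smul]
  have hA : ∀ (x : MonoidAlgebra ℂ G) (v : V), f (x • v) = x • f v := by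
    intro x
    induction x using MonoidAlgebra.induction_on with
    | of g => exact hG g
    | add x y hx hy => intro v; simp only [add_smul, map_add, hx, hy]
    | smul c x hx => intro v; simp only [smul_assoc, map_smul, hx]
  exact ⟨{ f with map_smul' := hA }, fun v => rfl⟩

/-- The Lie algebra sits inside `ℂG` and contains a generating set of `G`, so both notions of
linearity coincide. -/
theorem nonempty_equiv_iff_isoLie {S : Set G} (hS : Subgroup.closure S = ⊤) :
    Nonempty (V ≃ₗ[MonoidAlgebra ℂ G] W) ↔ IsoLie (lieGen S) V W := by
  rw [isoLie_iff]
  constructor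
  · rintro ⟨e⟩
    exact ⟨e.restrictScalars ℂ, fun x _ v => e.map_smul x v⟩
  · rintro ⟨f, hf⟩
    obtain ⟨e, -⟩ := nonempty_equiv_of_closure hS f fun s hs => hf _ (of_mem_lieGen hs)
    exact ⟨e⟩

/-- If every element of a generating set of `G` acts on a simple module by a scalar, then the
module is one-dimensional. -/
theorem finrank_le_one_of_scalar [IsSimpleModule (MonoidAlgebra ℂ G) V] {S : Set G}
    (hS : Subgroup.closure S = ⊤)
    (h : ∀ s ∈ S, ∃ c : ℂ, ∀ v : V, of ℂ G s • v = c • v) : Module.finrank ℂ V ≤ 1 := by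
  have hG : ∀ g : G, ∃ c : ℂ, ∀ v : V, of ℂ G g • v = c • v := by
    intro g
    have hg : g ∈ Subgroup.closure S := hS ▸ Subgroup.mem_top g
    induction hg using Subgroup.closure_induction with
    | mem s hs => exact h s hs
    | one => exact ⟨1, by simp only [map_one, one_smul, implies_true]⟩
    | mul x y _ _ hx hy =>
      obtain ⟨c, hc⟩ := hx
      obtain ⟨d, hd⟩ := hy
      exact ⟨d * c, fun v => by rw [map_mul, mul_smul, hd, smul_comm, hc, smul_smul]⟩
    | inv x _ hx =>
      obtain ⟨c, hc⟩ := hx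
      have hx : ∀ v : V, c • (of ℂ G x⁻¹ • v) = v := fun v => by
        rw [← hc, ← mul_smul, ← map_mul, mul_inv_cancel, map_one, one_smul]
      have : Nontrivial V := IsSimpleModule.nontrivial (MonoidAlgebra ℂ G) V
      obtain ⟨w, hw⟩ := exists_ne (0 : V)
      have hc0 : c ≠ 0 := by
        rintro rfl
        exact hw (by rw [← hx w, zero_smul])
      exact ⟨c⁻¹, fun v => by rw [eq_inv_smul_iff₀ hc0, hx]⟩
  have hA : ∀ x : MonoidAlgebra ℂ G, ∃ c : ℂ, ∀ v : V, x • v = c • v := by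
    intro x
    induction x using MonoidAlgebra.induction_on with
    | of g => exact hG g
    | add x y hx hy =>
      obtain ⟨c, hc⟩ := hx
      obtain ⟨d, hd⟩ := hy
      exact ⟨c + d, fun v => by rw [add_smul, add_smul, hc, hd]⟩
    | smul a x hx =>
      obtain ⟨c, hc⟩ := hx
      exact ⟨a * c, fun v => by rw [smul_assoc, hc, mul_smul]⟩
  have : Nontrivial V := IsSimpleModule.nontrivial (MonoidAlgebra ℂ G) V
  obtain ⟨w, hw⟩ := exists_ne (0 : V)
  -- A nonzero `w` generates the simple module, and `ℂG` acts by scalars, so the module is the line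
  -- through `w`.
  refine finrank_le_one w fun v => ?_
  obtain ⟨x, rfl⟩ := (IsSimpleModule.toSpanSingleton_surjective (MonoidAlgebra ℂ G) hw) v
  obtain ⟨c, hc⟩ := hA x
  exact ⟨c, (hc w).symm⟩

/-- Schur's lemma for a linear endomorphism that commutes with a generating set of `G`. -/
theorem exists_scalar_of_commute [IsSimpleModule (MonoidAlgebra ℂ G) V] [FiniteDimensional ℂ V]
    {S : Set G} (hS : Subgroup.closure S = ⊤) (g : G)
    (h : ∀ s ∈ S, ∀ v : V, of ℂ G g • of ℂ G s • v = of ℂ G s • of ℂ G g • v) :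
    ∃ c : ℂ, ∀ v : V, of ℂ G g • v = c • v := by
  let f : V ≃ₗ[ℂ] V :=
    { toFun := fun v => of ℂ G g • v
      invFun := fun v => of ℂ G g⁻¹ • v
      map_add' := smul_add _
      map_smul' := fun c v => smul_comm _ _ _
      left_inv := fun v => by simp [← mul_smul, ← map_mul, -of_apply]
      right_inv := fun v => by simp [← mul_smul, ← map_mul, -of_apply] }
  obtain ⟨e, he⟩ := nonempty_equiv_of_closure hS f h
  obtain ⟨c, hc⟩ := (IsSimpleModule.algebraMap_end_bijective_of_isAlgClosed ℂ).2 e.toLinearMap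
  exact ⟨c, fun v => by
    have := LinearMap.congr_fun hc v
    simpa [f, he] using this.symm⟩

/-- Schur's lemma for central elements of the group algebra. -/
theorem exists_scalar_of_central [IsSimpleModule (MonoidAlgebra ℂ G) V] [FiniteDimensional ℂ V]
    (z : MonoidAlgebra ℂ G) (hz : ∀ x, z * x = x * z) :
    ∃ c : ℂ, ∀ v : V, z • v = c • v := by
  let f : V →ₗ[MonoidAlgebra ℂ G] V :=
    { toFun := fun v => z • v
      map_add' := smul_add _
      map_smul' := fun x v => by
        simp only [← mul_smul, hz, RingHom.id_apply] }
  obtain ⟨c, hc⟩ := (IsSimpleModule.algebraMap_end_bijective_of_isAlgClosed ℂ).2 f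
  exact ⟨c, fun v => (LinearMap.congr_fun hc v).symm⟩

end GroupAlgebra

/-! ### The defect of a linear map on classes of involutions -/

section Involutions

open MonoidAlgebra

attribute [local instance] LieRing.ofAssociativeRing

variable {G : Type*} [Group G]
  {V : Type*} [AddCommGroup V] [Module ℂ V] [Module (MonoidAlgebra ℂ G) V]
  [IsScalarTower ℂ (MonoidAlgebra ℂ G) V]
  {W : Type*} [AddCommGroup W] [Module ℂ W] [Module (MonoidAlgebra ℂ G) W]
  [IsScalarTower ℂ (MonoidAlgebra ℂ G) W]

/-- The failure of a linear map `f` to commute with the action of `g`. -/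
def defect (f : V ≃ₗ[ℂ] W) (g : G) (v : V) : W := f (of ℂ G g • v) - of ℂ G g • f v

/-- Conjugate involutive generators differ by an element of the derived subalgebra, so a linear map
commuting with the latter has the same defect on both. -/
theorem defect_conj {S : Set G} (f : V ≃ₗ[ℂ] W)
    (hf : ∀ x ∈ lieGen S, ∀ y ∈ lieGen S, ∀ v,
      f ((x * y - y * x) • v) = (x * y - y * x) • f v)
    {k s : G} (hk : k ∈ S) (hs : s ∈ S) (hkk : k * k = 1) :
    defect f (k * s * k⁻¹) = defect f s := by
  have hkinv : k⁻¹ = k := inv_eq_of_mul_eq_one_left hkk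
  rw [hkinv]
  funext v
  set x := of ℂ G k with hx
  set y := of ℂ G s with hy
  have hxx : x * x = 1 := by rw [hx, ← map_mul, hkk, map_one]
  have hxy : x * y - y * x ∈ lieGen S :=
    (lieGen S).lie_mem (of_mem_lieGen hk) (of_mem_lieGen hs)
  have h := hf x (of_mem_lieGen hk) _ hxy v
  -- The double bracket isolates `y - x y x` because `x² = 1`; `hf` applies to it since the inner
  -- bracket is in the Lie algebra.
  have key : x * (x * y - y * x) - (x * y - y * x) * x = (2 : ℂ) • (y - x * y * x) := by
    have h1 : x * (x * y - y * x) - (x * y - y * x) * x =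
      (x * x) * y - x * y * x - x * y * x + y * (x * x) := by noncomm_ring
    rw [h1, hxx, two_smul]
    noncomm_ring
  rw [key, smul_assoc, smul_assoc, map_smul] at h
  have h2 := smul_right_injective W (two_ne_zero (α := ℂ)) h
  simp only [sub_smul, map_sub] at h2
  simp only [defect, map_mul, ← hx, ← hy]
  rw [sub_eq_sub_iff_add_eq_add] at h2 ⊢
  rw [add_comm, ← h2, add_comm]

/-- A linear map between simple modules with constant defect on a conjugation-invariant set of
involutions either commutes with all of them, or they act by opposite signs. -/
theorem commutes_or_opposite_signs
    [IsSimpleModule (MonoidAlgebra ℂ G) V] [FiniteDimensional ℂ V]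
    [IsSimpleModule (MonoidAlgebra ℂ G) W] [FiniteDimensional ℂ W] (f : V ≃ₗ[ℂ] W)
    {C : Set G} (hfin : C.Finite) (hconj : ∀ g, ∀ s ∈ C, g * s * g⁻¹ ∈ C)
    (hinv : ∀ s ∈ C, s * s = 1) (hdef : ∀ s ∈ C, ∀ u ∈ C, defect f s = defect f u) :
    (∀ s ∈ C, ∀ v, f (of ℂ G s • v) = of ℂ G s • f v) ∨
    ∃ ε : ℂ, (ε = 1 ∨ ε = -1) ∧ ∀ s ∈ C, (∀ v : V, of ℂ G s • v = ε • v) ∧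
      ∀ w : W, of ℂ G s • w = (-ε) • w := by
  classical
  set c := hfin.toFinset with hc
  have hmem : ∀ s, s ∈ c ↔ s ∈ C := fun s => hfin.mem_toFinset
  set T : MonoidAlgebra ℂ G := ∑ s ∈ c, of ℂ G s with hT
  have hTg : ∀ g : G, T * of ℂ G g = of ℂ G g * T := by
    intro g
    rw [hT, Finset.sum_mul, Finset.mul_sum]
    refine Finset.sum_bij' (fun s _ => g⁻¹ * s * g) (fun s _ => g * s * g⁻¹) ?_ ?_ ?_ ?_ ?_
    · intro s hs
      simpa using (hmem _).2 (hconj g⁻¹ s ((hmem s).1 hs))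
    · intro s hs
      exact (hmem _).2 (hconj g s ((hmem s).1 hs))
    · intro s _; group
    · intro s _; group
    · intro s _
      rw [← map_mul, ← map_mul]
      congr 1
      group
  have hcentral : ∀ x, T * x = x * T := by
    intro x
    induction x using MonoidAlgebra.induction_on with
    | of g => exact hTg g
    | add x y hx hy => rw [mul_add, add_mul, hx, hy]
    | smul a x hx => rw [mul_smul_comm, smul_mul_assoc, hx]
  obtain ⟨a, ha⟩ := exists_scalar_of_central (V := V) T hcentral
  obtain ⟨b, hb⟩ := exists_scalar_of_central (V := W) T hcentral
  rcases C.eq_empty_or_nonempty with rfl | ⟨s₀, hs₀⟩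
  · left; simp
  have hcard : (c.card : ℂ) ≠ 0 := by
    rw [Nat.cast_ne_zero, Finset.card_ne_zero]
    exact ⟨s₀, (hmem _).2 hs₀⟩
  -- The defects over `C` sum to `(a - b) f` and are all equal, hence each is `ω f`.
  set ω : ℂ := (c.card : ℂ)⁻¹ * (a - b) with hω
  have hdefect : ∀ s ∈ C, ∀ v, f (of ℂ G s • v) = of ℂ G s • f v + ω • f v := by
    intro s hs v
    have h1 : ∑ u ∈ c, defect f u v = (a - b) • f v := by
      simp only [defect, Finset.sum_sub_distrib]
      rw [← map_sum, ← Finset.sum_smul, ← Finset.sum_smul, ← hT, ha, hb, map_smul, sub_smul]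
    have h2 : ∑ u ∈ c, defect f u v = (c.card : ℂ) • defect f s v := by
      rw [Finset.sum_congr rfl fun u hu => congrFun (hdef u ((hmem u).1 hu) s hs) v,
        Finset.sum_const, Nat.cast_smul_eq_nsmul]
    have h3 : defect f s v = ω • f v := by
      rw [hω, mul_smul, ← h1, h2, inv_smul_smul₀ hcard]
    rw [← h3, defect]
    abel
  by_cases h0 : ω = 0
  · left
    intro s hs v
    rw [hdefect s hs, h0, zero_smul, add_zero]
  right
  -- Expanding `f (s (s v)) = f v` twice with `hdefect` leaves `2ω (s + ω/2) f v = 0`.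
  have hW : ∀ s ∈ C, ∀ w : W, of ℂ G s • w = (-(ω / 2)) • w := by
    intro s hs w
    obtain ⟨v, rfl⟩ := f.surjective w
    have h1 := hdefect s hs (of ℂ G s • v)
    have hss : of ℂ G s * of ℂ G s = 1 := by rw [← map_mul, hinv s hs, map_one]
    rw [← mul_smul, hss, one_smul, hdefect s hs, smul_add, ← mul_smul, hss, one_smul, smul_add,
      smul_comm (of ℂ G s) ω] at h1
    have h2 : (2 * ω) • (of ℂ G s • f v + (ω / 2) • f v) = 0 := by
      have h3 : (2 * ω) • (of ℂ G s • f v + (ω / 2) • f v) = (f v + ω • of ℂ G s • f v +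
        (ω • of ℂ G s • f v + ω • ω • f v)) - f v := by
        generalize of ℂ G s • f v = z
        module
      rw [h3, ← h1, sub_self]
    have h4 := (smul_eq_zero.1 h2).resolve_left (mul_ne_zero two_ne_zero h0)
    rw [neg_smul]
    exact eq_neg_of_add_eq_zero_left h4
  have hV : ∀ s ∈ C, ∀ v : V, of ℂ G s • v = (ω / 2) • v := by
    intro s hs v
    apply f.injective
    rw [hdefect s hs, hW s hs, map_smul]
    module
  refine ⟨ω / 2, ?_, fun s hs => ⟨hV s hs, hW s hs⟩⟩
  have : Nontrivial V := IsSimpleModule.nontrivial (MonoidAlgebra ℂ G) V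
  obtain ⟨v, hv⟩ := exists_ne (0 : V)
  have hss : of ℂ G s₀ * of ℂ G s₀ = 1 := by rw [← map_mul, hinv s₀ hs₀, map_one]
  have h1 : of ℂ G s₀ • of ℂ G s₀ • v = v := by rw [← mul_smul, hss, one_smul]
  rw [hV _ hs₀, hV _ hs₀, smul_smul] at h1
  have h2 : (ω / 2 * (ω / 2) - 1) • v = 0 := by rw [sub_smul, h1, one_smul, sub_self]
  exact mul_self_eq_one_iff.1 (sub_eq_zero.1 ((smul_eq_zero.1 h2).resolve_right hv))

end Involutions

/-! ### Reflections in the groups of signed permutations -/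

section SignedPermutations

open Equiv

variable {n : ℕ}

theorem perm_mul (σ τ : Perm (Fin n)) : perm (σ * τ) = perm σ * perm τ := map_mul _ _ _

theorem t_mul_self (i : Fin n) : t i * t i = 1 := by
  simp [t, ← map_mul, ← Pi.mulSingle_mul]

theorem t_mul_t_comm (i j : Fin n) : t i * t j = t j * t i := by
  simp only [t, ← map_mul, mul_comm]

theorem perm_mul_t (σ : Perm (Fin n)) (i : Fin n) : perm σ * t i = t (σ i) * perm σ := by
  refine SemidirectProduct.ext (funext fun j => ?_) (by simp [perm, t])
  change (1 : ℤˣ) * (Pi.mulSingle i (-1) : Fin n → ℤˣ) (σ⁻¹ j) =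
    (Pi.mulSingle (σ i) (-1) : Fin n → ℤˣ) j * 1
  simp only [Pi.mulSingle_apply, Perm.inv_eq_iff_eq, one_mul, mul_one]

theorem swap_perm_mul_self (i j : Fin n) : perm (swap i j) * perm (swap i j) = 1 := by
  rw [← perm_mul, swap_mul_self]; exact map_one _

theorem t_inv (i : Fin n) : (t i)⁻¹ = t i := inv_eq_of_mul_eq_one_left (t_mul_self i)

theorem perm_swap_inv (i j : Fin n) : (perm (swap i j))⁻¹ = perm (swap i j) :=
  inv_eq_of_mul_eq_one_left (swap_perm_mul_self i j)

theorem perm_conj_swap (σ : Perm (Fin n)) (i j : Fin n) :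
    perm σ * perm (swap i j) * (perm σ)⁻¹ = perm (swap (σ i) (σ j)) := by
  rw [← perm_mul, mul_inv_eq_iff_eq_mul, ← perm_mul, swap_apply_apply]
  simp

theorem perm_conj_t (σ : Perm (Fin n)) (i : Fin n) : perm σ * t i * (perm σ)⁻¹ = t (σ i) := by
  rw [perm_mul_t, mul_inv_cancel_right]

/-- The reflection `t_i t_j (i,j)`. -/
def negSwap (i j : Fin n) : B n := t i * t j * perm (swap i j)

theorem negSwap_comm (i j : Fin n) : negSwap i j = negSwap j i := by
  rw [negSwap, negSwap, t_mul_t_comm, swap_comm]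

theorem t_conj_swap_left (i j : Fin n) : t i * perm (swap i j) * (t i)⁻¹ = negSwap i j := by
  rw [t_inv, mul_assoc, perm_mul_t, swap_apply_left, ← mul_assoc, negSwap]

theorem t_conj_negSwap_left (i j : Fin n) : t i * negSwap i j * (t i)⁻¹ = perm (swap i j) := by
  rw [← t_conj_swap_left, t_inv]
  simp only [mul_assoc, t_mul_self, mul_one]
  rw [← mul_assoc, t_mul_self, one_mul]

theorem perm_conj_negSwap (σ : Perm (Fin n)) (i j : Fin n) :
    perm σ * negSwap i j * (perm σ)⁻¹ = negSwap (σ i) (σ j) := by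
  rw [negSwap, negSwap, ← perm_conj_swap, ← perm_conj_t, ← perm_conj_t]
  group

theorem negSwap_eq_mul (i j : Fin n) : negSwap i j = perm (swap i j) * (t i * t j) := by
  rw [← mul_assoc, perm_mul_t, mul_assoc, perm_mul_t, swap_apply_left, swap_apply_right,
    ← mul_assoc, t_mul_t_comm j i, negSwap]

theorem negSwap_mul_self (i j : Fin n) : negSwap i j * negSwap i j = 1 := by
  rw [← t_conj_swap_left]
  calc _ = t i * (perm (swap i j) * perm (swap i j)) * (t i)⁻¹ := by group
    _ = 1 := by rw [swap_perm_mul_self]; group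

theorem t_conj_swap_of_ne {i j k : Fin n} (hi : k ≠ i) (hj : k ≠ j) :
    t k * perm (swap i j) * (t k)⁻¹ = perm (swap i j) := by
  rw [mul_inv_eq_iff_eq_mul, perm_mul_t, swap_apply_of_ne_of_ne hi hj]

theorem t_conj_t (i k : Fin n) : t k * t i * (t k)⁻¹ = t i := by
  rw [t_mul_t_comm, mul_inv_cancel_right]

theorem t_conj_negSwap_of_ne {i j k : Fin n} (hi : k ≠ i) (hj : k ≠ j) :
    t k * negSwap i j * (t k)⁻¹ = negSwap i j := by
  calc _ = (t k * t i * (t k)⁻¹) * (t k * t j * (t k)⁻¹) *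
        (t k * perm (swap i j) * (t k)⁻¹) := by rw [negSwap]; group
    _ = _ := by rw [t_conj_t, t_conj_t, t_conj_swap_of_ne hi hj, negSwap]

theorem mem_reflSwap_iff {g : B n} :
    g ∈ reflSwap n ↔ ∃ i j : Fin n, i ≠ j ∧ (g = perm (swap i j) ∨ g = negSwap i j) := by
  constructor
  · rintro ⟨i, j, hij, h⟩
    exact ⟨i, j, hij.ne, h⟩
  · rintro ⟨i, j, hij, h⟩
    rcases lt_or_gt_of_ne hij with hlt | hlt
    · exact ⟨i, j, hlt, h⟩
    · exact ⟨j, i, hlt, h.imp (fun h => by rw [h, swap_comm])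
        (fun h => by rw [h, negSwap_comm, negSwap])⟩

theorem swap_mem_reflSwap {i j : Fin n} (h : i ≠ j) : perm (swap i j) ∈ reflSwap n :=
  mem_reflSwap_iff.2 ⟨i, j, h, Or.inl rfl⟩

theorem negSwap_mem_reflSwap {i j : Fin n} (h : i ≠ j) : negSwap i j ∈ reflSwap n :=
  mem_reflSwap_iff.2 ⟨i, j, h, Or.inr rfl⟩

theorem mul_self_of_mem_reflSwap {g : B n} (hg : g ∈ reflSwap n) : g * g = 1 := by
  obtain ⟨i, j, -, rfl | rfl⟩ := mem_reflSwap_iff.1 hg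
  · exact swap_perm_mul_self i j
  · exact negSwap_mul_self i j

theorem epsPrime_t (i : Fin n) : epsPrime n (t i) = -1 := by
  change ∏ j, (Pi.mulSingle i (-1) : Fin n → ℤˣ) j = -1
  rw [Finset.prod_eq_single i] <;> simp +contextual

theorem epsPrime_perm (σ : Perm (Fin n)) : epsPrime n (perm σ) = 1 := by
  change ∏ j, (1 : Fin n → ℤˣ) j = 1
  simp

theorem epsPrime_of_mem_reflSwap {g : B n} (hg : g ∈ reflSwap n) : epsPrime n g = 1 := by
  obtain ⟨i, j, -, rfl | rfl⟩ := mem_reflSwap_iff.1 hg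
  · exact epsPrime_perm _
  · simp [negSwap, epsPrime_t, epsPrime_perm]

/-! ### Generation by reflections -/

theorem perm_mem_of_swap_mem {H : Subgroup (B n)}
    (h : ∀ i j : Fin n, i ≠ j → perm (swap i j) ∈ H) (σ : Perm (Fin n)) : perm σ ∈ H := by
  have : Subgroup.closure {σ : Perm (Fin n) | σ.IsSwap} ≤ H.comap SemidirectProduct.inr := by
    rw [Subgroup.closure_le]
    rintro _ ⟨i, j, hij, rfl⟩
    exact h i j hij
  rw [Perm.closure_isSwap] at this
  exact this (Subgroup.mem_top σ)

theorem eq_inl_mul_perm (g : B n) : g = SemidirectProduct.inl g.left * perm g.right :=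
  (SemidirectProduct.inl_left_mul_inr_right g).symm

theorem inl_mulSingle (i : Fin n) (u : ℤˣ) :
    (SemidirectProduct.inl (Pi.mulSingle i u) : B n) = 1 ∨
      (SemidirectProduct.inl (Pi.mulSingle i u) : B n) = t i := by
  rcases Int.units_eq_one_or u with rfl | rfl
  · left; simp
  · right; rfl

theorem closure_swap_t :
    Subgroup.closure ({g : B n | ∃ i j, i ≠ j ∧ g = perm (swap i j)} ∪ Set.range t) = ⊤ := by
  rw [eq_top_iff]
  intro g _
  rw [eq_inl_mul_perm g]
  refine mul_mem ?_ (perm_mem_of_swap_mem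
    (fun i j hij => Subgroup.subset_closure (Or.inl ⟨i, j, hij, rfl⟩)) _)
  rw [← Subgroup.mem_comap, ← Finset.univ_prod_mulSingle g.left]
  refine prod_mem fun i _ => Subgroup.mem_comap.2 ?_
  rcases inl_mulSingle i (g.left i) with h | h <;> rw [h]
  · exact one_mem _
  · exact Subgroup.subset_closure (Or.inr ⟨i, rfl⟩)

theorem closure_reflB : Subgroup.closure (reflB n) = ⊤ := by
  rw [eq_top_iff, ← closure_swap_t]
  refine Subgroup.closure_mono (Set.union_subset_union_left _ ?_)
  rintro _ ⟨i, j, hij, rfl⟩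
  exact swap_mem_reflSwap hij

theorem t_mul_t_mem_closure_reflSwap (i j : Fin n) :
    t i * t j ∈ Subgroup.closure (reflSwap n) := by
  by_cases hij : i = j
  · rw [hij, t_mul_self]; exact one_mem _
  · have : t i * t j = negSwap i j * perm (swap i j) := by
      rw [negSwap, mul_assoc, swap_perm_mul_self, mul_one]
    rw [this]
    exact mul_mem (Subgroup.subset_closure (negSwap_mem_reflSwap hij))
      (Subgroup.subset_closure (swap_mem_reflSwap hij))

theorem closure_reflSwap : Subgroup.closure (reflSwap n) = D n := by
  apply le_antisymm
  · rw [Subgroup.closure_le]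
    exact fun g hg => MonoidHom.mem_ker.2 (epsPrime_of_mem_reflSwap hg)
  intro g hg
  have hperm : perm g.right ∈ Subgroup.closure (reflSwap n) :=
    perm_mem_of_swap_mem (fun i j hij => Subgroup.subset_closure (swap_mem_reflSwap hij)) _
  rw [eq_inl_mul_perm g]
  refine mul_mem ?_ hperm
  rcases isEmpty_or_nonempty (Fin n) with hn | ⟨⟨o⟩⟩
  · rw [Subsingleton.elim g.left 1, map_one]; exact one_mem _
  -- Each sign change `t i` is paired with one at a fixed position `o`; `u` records the sign
  -- accumulated at `o`.
  have key : ∀ s : Finset (Fin n), ∃ u : ℤˣ,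
      (SemidirectProduct.inl (∏ i ∈ s, Pi.mulSingle i (g.left i)) : B n) *
        SemidirectProduct.inl (Pi.mulSingle o u) ∈ Subgroup.closure (reflSwap n) := by
    intro s
    induction s using Finset.induction_on with
    | empty => exact ⟨1, by simp⟩
    | insert i s his ih =>
      obtain ⟨u, hu⟩ := ih
      rcases Int.units_eq_one_or (g.left i) with h1 | h1
      · exact ⟨u, by rwa [Finset.prod_insert his, h1, Pi.mulSingle_one, one_mul]⟩
      · refine ⟨-u, ?_⟩
        have h2 : (SemidirectProduct.inl (∏ j ∈ insert i s, Pi.mulSingle j (g.left j)) : B n) *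
            SemidirectProduct.inl (Pi.mulSingle o (-u)) = (t i * t o) *
              (SemidirectProduct.inl (∏ j ∈ s, Pi.mulSingle j (g.left j)) *
                SemidirectProduct.inl (Pi.mulSingle o u)) := by
          rw [Finset.prod_insert his, h1, t, t, ← neg_one_mul u, Pi.mulSingle_mul]
          simp only [← map_mul]
          congr 1
          ac_rfl
        rw [h2]
        exact mul_mem (t_mul_t_mem_closure_reflSwap i o) hu
  obtain ⟨u, hu⟩ := key Finset.univ
  rw [Finset.univ_prod_mulSingle] at hu
  have heps : ∀ x ∈ Subgroup.closure (reflSwap n), epsPrime n x = 1 := by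
    change Subgroup.closure (reflSwap n) ≤ (epsPrime n).ker
    rw [Subgroup.closure_le]
    exact fun x hx => MonoidHom.mem_ker.2 (epsPrime_of_mem_reflSwap hx)
  have hg' : epsPrime n (SemidirectProduct.inl g.left) = 1 := by
    have h3 := MonoidHom.mem_ker.1 hg
    rwa [eq_inl_mul_perm g, map_mul, epsPrime_perm, mul_one] at h3
  -- A leftover `t o` would have `ε' = -1`, impossible since `ε'` is trivial on both `g` and the
  -- closure.
  rcases inl_mulSingle o u with h | h
  · rwa [h, mul_one] at hu
  · have h3 := heps _ hu
    rw [h, map_mul, hg', epsPrime_t] at h3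
    exact absurd h3 (by decide)

theorem closure_reflD : Subgroup.closure (reflD n) = ⊤ := by
  apply Subgroup.map_injective (D n).subtype_injective
  rw [MonoidHom.map_closure, ← MonoidHom.range_eq_map, Subgroup.range_subtype]
  refine Eq.trans (congrArg _ ?_) closure_reflSwap
  ext g
  constructor
  · rintro ⟨x, hx, rfl⟩
    exact hx
  · exact fun hg => ⟨⟨g, MonoidHom.mem_ker.2 (epsPrime_of_mem_reflSwap hg)⟩, hg, rfl⟩

/-! ### Conjugacy of reflections -/

/-- A set stable under conjugation by involutive generators is stable under conjugation. -/
theorem conj_mem_of_generators {G : Type*} [Group G] {S X : Set G}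
    (hS : Subgroup.closure S = ⊤) (hinv : ∀ k ∈ S, k⁻¹ = k)
    (h : ∀ k ∈ S, ∀ x ∈ X, k * x * k⁻¹ ∈ X) (g : G) : ∀ x ∈ X, g * x * g⁻¹ ∈ X := by
  suffices H : ∀ g ∈ Subgroup.closure S,
      -- Conjugation by `g⁻¹` is carried along so that the inverse case of the induction closes.
      (∀ x ∈ X, g * x * g⁻¹ ∈ X) ∧ ∀ x ∈ X, g⁻¹ * x * g ∈ X from
    (H g (hS ▸ Subgroup.mem_top g)).1
  intro g hg
  induction hg using Subgroup.closure_induction with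
  | mem k hk =>
    refine ⟨h k hk, fun x hx => ?_⟩
    have := h k hk x hx
    rwa [hinv k hk] at this ⊢
  | one => simp
  | mul a b _ _ ha hb =>
    refine ⟨fun x hx => ?_, fun x hx => ?_⟩
    · have := ha.1 _ (hb.1 x hx)
      simpa only [mul_inv_rev, mul_assoc] using this
    · have := hb.2 _ (ha.2 x hx)
      simpa only [mul_inv_rev, mul_assoc] using this
  | inv a _ ha => simpa only [inv_inv] using ha.symm

theorem inv_of_mem_swap_t {k : B n}
    (hk : k ∈ {g : B n | ∃ i j, i ≠ j ∧ g = perm (swap i j)} ∪ Set.range t) : k⁻¹ = k := by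
  rcases hk with ⟨i, j, -, rfl⟩ | ⟨i, rfl⟩
  · exact perm_swap_inv i j
  · exact t_inv i

theorem conj_mem_reflSwap (g : B n) : ∀ x ∈ reflSwap n, g * x * g⁻¹ ∈ reflSwap n := by
  refine conj_mem_of_generators closure_swap_t (fun k hk => inv_of_mem_swap_t hk) ?_ g
  intro k hk x hx
  obtain ⟨i, j, hij, hx⟩ := mem_reflSwap_iff.1 hx
  rcases hk with ⟨a, b, -, rfl⟩ | ⟨k, rfl⟩
  · have hne : swap a b i ≠ swap a b j := fun h => hij ((swap a b).injective h)
    rcases hx with rfl | rfl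
    · rw [perm_conj_swap]; exact swap_mem_reflSwap hne
    · rw [perm_conj_negSwap]; exact negSwap_mem_reflSwap hne
  · by_cases hki : k = i
    · subst hki
      rcases hx with rfl | rfl
      · rw [t_conj_swap_left]; exact negSwap_mem_reflSwap hij
      · rw [t_conj_negSwap_left]; exact swap_mem_reflSwap hij
    by_cases hkj : k = j
    · subst hkj
      rcases hx with rfl | rfl
      · rw [swap_comm, t_conj_swap_left]; exact negSwap_mem_reflSwap hij.symm
      · rw [negSwap_comm, t_conj_negSwap_left]; exact swap_mem_reflSwap hij.symm
    rcases hx with rfl | rfl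
    · rw [t_conj_swap_of_ne hki hkj]; exact swap_mem_reflSwap hij
    · rw [t_conj_negSwap_of_ne hki hkj]; exact negSwap_mem_reflSwap hij

theorem conj_mem_range_t (g : B n) : ∀ x ∈ Set.range (t (n := n)), g * x * g⁻¹ ∈ Set.range t := by
  refine conj_mem_of_generators closure_swap_t (fun k hk => inv_of_mem_swap_t hk) ?_ g
  rintro k hk _ ⟨i, rfl⟩
  rcases hk with ⟨a, b, -, rfl⟩ | ⟨k, rfl⟩
  · rw [perm_conj_t]; exact ⟨_, rfl⟩
  · rw [t_conj_t]; exact ⟨_, rfl⟩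

/-- A function on `B_n` that is invariant under conjugation of reflections by the reflections
`(i,j)` takes the same value on all `(i,j)`. -/
theorem swap_value_eq {X : Type*} (δ : B n → X)
    (hδ : ∀ k ∈ reflSwap n, ∀ s ∈ reflSwap n, δ (k * s * k⁻¹) = δ s)
    {i j i' j' : Fin n} (h : i ≠ j) (h' : i' ≠ j') :
    δ (perm (swap i j)) = δ (perm (swap i' j')) := by
  -- Transpositions sharing an entry are conjugate by a transposition; two arbitrary ones are joined
  -- through `(j, i')`.
  have base : ∀ {i j k : Fin n}, i ≠ j → i ≠ k →
      δ (perm (swap i j)) = δ (perm (swap i k)) := by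
    intro i j k hij hik
    by_cases hjk : j = k
    · rw [hjk]
    · have := hδ _ (swap_mem_reflSwap hjk) _ (swap_mem_reflSwap hij)
      rwa [perm_conj_swap, swap_apply_of_ne_of_ne hij hik, swap_apply_left, eq_comm] at this
  by_cases hj : i' = j
  · subst hj
    rw [swap_comm]
    exact base h.symm h'
  · rw [swap_comm i j, base h.symm (Ne.symm hj), swap_comm, base hj h']

/-- Isolates the one link that differs between the types: `hneg` comes from a third index in `D_n`
and from conjugation by `t i` in `B_n`. -/
theorem reflSwap_value_eq {X : Type*} (δ : B n → X)
    (hδ : ∀ k ∈ reflSwap n, ∀ s ∈ reflSwap n, δ (k * s * k⁻¹) = δ s)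
    (hneg : ∀ i j, i ≠ j → δ (negSwap i j) = δ (perm (swap i j))) :
    ∀ s ∈ reflSwap n, ∀ u ∈ reflSwap n, δ s = δ u := by
  have key : ∀ {s}, s ∈ reflSwap n → ∃ i j, i ≠ j ∧ δ s = δ (perm (swap i j)) := by
    intro s hs
    obtain ⟨i, j, hij, rfl | rfl⟩ := mem_reflSwap_iff.1 hs
    · exact ⟨i, j, hij, rfl⟩
    · exact ⟨i, j, hij, hneg i j hij⟩
  intro s hs u hu
  obtain ⟨i, j, hij, h1⟩ := key hs
  obtain ⟨k, l, hkl, h2⟩ := key hu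
  rw [h1, h2, swap_value_eq δ hδ hij hkl]

/-- A third index lets a reflection of `D_n` turn an unsigned transposition into a signed one. -/
theorem negSwap_conj_swap {i j k : Fin n} (hij : i ≠ j) (hjk : j ≠ k) (hik : i ≠ k) :
    negSwap i k * perm (swap i j) * (negSwap i k)⁻¹ = negSwap k j := by
  have h1 : perm (swap i k) * perm (swap i j) * (perm (swap i k))⁻¹ = perm (swap k j) := by
    rw [perm_conj_swap, swap_apply_left, swap_apply_of_ne_of_ne hij.symm hjk]
  calc _ = t i * (t k * (perm (swap i k) * perm (swap i j) * (perm (swap i k))⁻¹) * (t k)⁻¹) *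
        (t i)⁻¹ := by rw [negSwap]; group
    _ = negSwap k j := by
      rw [h1, t_conj_swap_left]
      exact t_conj_negSwap_of_ne hik hij

/-- For `n ≥ 3` all the reflections of `D_n` are conjugate in `D_n`. -/
theorem negSwap_value_eq (hn : 3 ≤ n) {X : Type*} (δ : B n → X)
    (hδ : ∀ k ∈ reflSwap n, ∀ s ∈ reflSwap n, δ (k * s * k⁻¹) = δ s) (i j : Fin n) (hij : i ≠ j) :
    δ (negSwap i j) = δ (perm (swap i j)) := by
  obtain ⟨k, hk⟩ : ∃ k : Fin n, k ∉ ({i, j} : Finset (Fin n)) := by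
    by_contra! h
    have h1 : (Finset.univ : Finset (Fin n)).card ≤ ({i, j} : Finset (Fin n)).card :=
      Finset.card_le_card fun x _ => h x
    have h2 := Finset.card_le_two (a := i) (b := j)
    rw [Finset.card_univ, Fintype.card_fin] at h1
    omega
  simp only [Finset.mem_insert, Finset.mem_singleton, not_or] at hk
  have h1 := hδ _ (negSwap_mem_reflSwap hk.1) _ (swap_mem_reflSwap hk.2)
  rw [negSwap_conj_swap hk.2 hij.symm hk.1] at h1
  rw [h1]
  exact swap_value_eq δ hδ hk.2 hij

/-- Covers the case without a third index: `D_2` is commutative, so its simple modules are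
one-dimensional. -/
theorem reflSwap_two_commute (hn : n = 2) {s u : B n} (hs : s ∈ reflSwap n)
    (hu : u ∈ reflSwap n) : s * u = u * s := by
  subst hn
  have key : ∀ {s : B 2}, s ∈ reflSwap 2 → s = perm (swap 0 1) ∨ s = negSwap 0 1 := by
    rintro s ⟨i, j, hij, h⟩
    have hi : i = 0 := by omega
    have hj : j = 1 := by omega
    subst hi hj
    exact h
  have hc : perm (swap 0 1) * negSwap (0 : Fin 2) 1 = negSwap 0 1 * perm (swap 0 1) := by
    conv_lhs => rw [negSwap_eq_mul, ← mul_assoc, swap_perm_mul_self, one_mul]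
    rw [negSwap, mul_assoc, swap_perm_mul_self, mul_one]
  rcases key hs with rfl | rfl <;> rcases key hu with rfl | rfl
  · rfl
  · exact hc
  · exact hc.symm
  · rfl

end SignedPermutations

/-! ### Combinatorics of tableaux -/

section Tableaux

open Finset

variable {n : ℕ} (lam : YoungDiagram) (h : lam.card = n) (mu : YoungDiagram) (h' : mu.card = n)

/-- The row of an entry of the tableau. -/
def rowOf (i : Fin n) : ℕ := ((tableau lam h).symm i).1.1

/-- The column of an entry of the tableau. -/
def colOf (i : Fin n) : ℕ := ((tableau lam h).symm i).1.2

variable {lam h} in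
theorem eq_of_rowOf_colOf {i j : Fin n} (hr : rowOf lam h i = rowOf lam h j)
    (hc : colOf lam h i = colOf lam h j) : i = j :=
  (tableau lam h).symm.injective (Subtype.ext (Prod.ext hr hc))

theorem rowOf_colOf_mem (i : Fin n) : (rowOf lam h i, colOf lam h i) ∈ lam :=
  ((tableau lam h).symm i).2

theorem exists_rowOf_colOf {r c : ℕ} (hrc : (r, c) ∈ lam) :
    ∃ i, rowOf lam h i = r ∧ colOf lam h i = c :=
  ⟨tableau lam h ⟨(r, c), hrc⟩, by simp [rowOf], by simp [colOf]⟩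

/-- The number of entries in the first `k` rows. -/
def entriesAbove (k : ℕ) : ℕ := #{i | rowOf lam h i < k}

variable {lam h mu h'}

theorem entriesAbove_succ (k : ℕ) :
    entriesAbove lam h (k + 1) = entriesAbove lam h k + #{i | rowOf lam h i = k} := by
  rw [entriesAbove, entriesAbove, ← card_union_of_disjoint]
  · congr 1
    ext i
    simp only [mem_filter, mem_univ, true_and, mem_union]
    omega
  · rw [disjoint_filter]
    intro i _ h1 h2
    omega

theorem card_rowOf_eq (k : ℕ) : #{i | rowOf lam h i = k} = lam.rowLen k := by
  rw [← card_range (lam.rowLen k)]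
  refine card_bij (fun i _ => colOf lam h i) ?_ ?_ ?_
  · intro i hi
    rw [mem_range, ← YoungDiagram.mem_iff_lt_rowLen, ← (mem_filter.1 hi).2]
    exact rowOf_colOf_mem lam h i
  · intro i hi j hj hij
    exact eq_of_rowOf_colOf ((mem_filter.1 hi).2.trans (mem_filter.1 hj).2.symm) hij
  · intro c hc
    obtain ⟨i, hi, hc⟩ := exists_rowOf_colOf lam h
      (YoungDiagram.mem_iff_lt_rowLen.2 (mem_range.1 hc))
    exact ⟨i, by simp [hi], hc⟩

/-- A Young diagram is determined by the partial sums of its row lengths. -/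
theorem eq_of_entriesAbove_eq (H : ∀ k, entriesAbove lam h k = entriesAbove mu h' k) :
    lam = mu := by
  have hlen : ∀ k, lam.rowLen k = mu.rowLen k := by
    intro k
    rw [← card_rowOf_eq (h := h), ← card_rowOf_eq (h := h')]
    have h1 := H (k + 1)
    rw [entriesAbove_succ, entriesAbove_succ, H k] at h1
    exact Nat.add_left_cancel h1
  refine SetLike.ext fun ⟨i, j⟩ => ?_
  rw [YoungDiagram.mem_iff_lt_rowLen, YoungDiagram.mem_iff_lt_rowLen, hlen]

/-- The permutation `g` sends distinct entries of a row of one tableau to distinct columns of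
another one. -/
def RowsToColumns (h : lam.card = n) (h' : mu.card = n) (g : Equiv.Perm (Fin n)) : Prop :=
  ∀ i j, i ≠ j → rowOf mu h' i = rowOf mu h' j → colOf lam h (g i) ≠ colOf lam h (g j)

/-- The left set has at most one element per row and embeds in column `c` via `g`, so it has size at
most `min k (colLen c)`, which the tableau itself attains. -/
theorem RowsToColumns.card_le {g : Equiv.Perm (Fin n)} (hg : RowsToColumns h h' g) (k c : ℕ) :
    #{i | rowOf mu h' i < k ∧ colOf lam h (g i) = c} ≤
      #{i | rowOf lam h i < k ∧ colOf lam h i = c} := by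
  have h1 : #{i | rowOf mu h' i < k ∧ colOf lam h (g i) = c} ≤ k := by
    conv_rhs => rw [← card_range k]
    refine card_le_card_of_injOn (rowOf mu h') ?_ ?_
    · intro i hi
      simpa using (mem_filter.1 hi).2.1
    · intro i hi j hj hij
      by_contra hne
      exact hg i j hne hij
        ((mem_filter.1 hi).2.2.trans (mem_filter.1 hj).2.2.symm)
  have h2 : #{i | rowOf mu h' i < k ∧ colOf lam h (g i) = c} ≤ lam.colLen c := by
    rw [← card_range (lam.colLen c)]
    refine card_le_card_of_injOn (fun i => rowOf lam h (g i)) ?_ ?_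
    · intro i hi
      rw [mem_coe, mem_range, ← YoungDiagram.mem_iff_lt_colLen, ← (mem_filter.1 hi).2.2]
      exact rowOf_colOf_mem lam h (g i)
    · intro i hi j hj hij
      exact g.injective (eq_of_rowOf_colOf hij
        ((mem_filter.1 hi).2.2.trans (mem_filter.1 hj).2.2.symm))
  refine (le_min h1 h2).trans ?_
  rw [← card_range (min k (lam.colLen c))]
  have hmem : ∀ r ∈ range (min k (lam.colLen c)), (r, c) ∈ lam := fun r hr =>
    YoungDiagram.mem_iff_lt_colLen.2 ((mem_range.1 hr).trans_le (min_le_right _ _))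
  refine card_le_card_of_surjOn (rowOf lam h) fun r hr => ?_
  obtain ⟨i, hi, hc⟩ := exists_rowOf_colOf lam h (hmem r hr)
  have hr' := (mem_range.1 hr).trans_le (min_le_left _ _)
  exact ⟨i, by simp [hi, hc, hr'], hi⟩

theorem sum_card_colOf (k : ℕ) (P : Fin n → ℕ) (g : Equiv.Perm (Fin n)) :
    #{i | P i < k} = ∑ c ∈ univ.image (colOf lam h), #{i | P i < k ∧ colOf lam h (g i) = c} := by
  rw [card_eq_sum_card_fiberwise (f := fun i => colOf lam h (g i)) (t := univ.image (colOf lam h))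
    (fun i _ => by simp)]
  simp only [filter_filter]

/-- Dominance: the existence of such a permutation bounds partial sums of row lengths. -/
theorem RowsToColumns.entriesAbove_le {g : Equiv.Perm (Fin n)} (hg : RowsToColumns h h' g)
    (k : ℕ) : entriesAbove mu h' k ≤ entriesAbove lam h k := by
  rw [entriesAbove, entriesAbove, sum_card_colOf (lam := lam) (h := h) k (rowOf mu h') g,
    sum_card_colOf (lam := lam) (h := h) k (rowOf lam h) 1]
  exact sum_le_sum fun c _ => hg.card_le k c

/-- The inequalities of `card_le` have equal sums over all columns, so each is an equality. -/
theorem RowsToColumns.card_eq {g : Equiv.Perm (Fin n)} (hg : RowsToColumns h h g) (k i) :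
    #{j | rowOf lam h j < k ∧ colOf lam h (g j) = colOf lam h i} =
      #{j | rowOf lam h j < k ∧ colOf lam h j = colOf lam h i} := by
  refine (sum_eq_sum_iff_of_le (s := univ.image (colOf lam h))
    fun c _ => hg.card_le k c).1 ?_ _ (mem_image_of_mem _ (mem_univ i))
  exact (sum_card_colOf (lam := lam) (h := h) k (rowOf lam h) g).symm.trans
    (sum_card_colOf (lam := lam) (h := h) k (rowOf lam h) 1)

/-- A permutation sending distinct entries of each row to distinct columns is the product of a
column-preserving and a row-preserving permutation. -/
theorem RowsToColumns.exists_factorization {g : Equiv.Perm (Fin n)} (hg : RowsToColumns h h g) :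
    ∃ c r : Equiv.Perm (Fin n), g = c * r ∧ (∀ i, colOf lam h (c i) = colOf lam h i) ∧
      ∀ i, rowOf lam h (r i) = rowOf lam h i := by
  -- The count in the column of `g i` grows strictly from rows below `k` to rows below `k + 1`. By
  -- `card_eq` it also grows for the tableau itself, which gives a box in row `k`.
  have key : ∀ i, ∃ j, rowOf lam h j = rowOf lam h i ∧ colOf lam h j = colOf lam h (g i) := by
    intro i
    set k := rowOf lam h i with hk
    have hlt : #{j | rowOf lam h j < k ∧ colOf lam h (g j) = colOf lam h (g i)} <
        #{j | rowOf lam h j < k + 1 ∧ colOf lam h (g j) = colOf lam h (g i)} := by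
      refine card_lt_card (Finset.ssubset_iff_subset_ne.2 ⟨fun j hj => ?_, fun he => ?_⟩)
      · simp only [mem_filter, mem_univ, true_and] at hj ⊢
        exact ⟨by omega, hj.2⟩
      · have : i ∈ ({j | rowOf lam h j < k + 1 ∧ colOf lam h (g j) = colOf lam h (g i)} :
            Finset (Fin n)) := by simp [← hk]
        rw [← he] at this
        simp [← hk] at this
    rw [hg.card_eq, hg.card_eq] at hlt
    obtain ⟨j, hj, hj'⟩ := exists_mem_notMem_of_card_lt_card hlt
    simp only [mem_filter, mem_univ, true_and] at hj hj'
    have h1 : ¬ rowOf lam h j < k := fun h1 => hj' ⟨h1, hj.2⟩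
    exact ⟨j, by omega, hj.2⟩
  choose r hr hc using key
  have hinj : Function.Injective r := by
    intro i j hij
    by_contra hne
    refine hg i j hne ?_ ?_
    · rw [← hr i, hij, hr j]
    · rw [← hc i, hij, hc j]
  let ρ : Equiv.Perm (Fin n) := Equiv.ofBijective r (Finite.injective_iff_bijective.1 hinj)
  refine ⟨g * ρ⁻¹, ρ, by group, fun i => ?_, hr⟩
  obtain ⟨j, rfl⟩ := ρ.surjective i
  have hj : ρ⁻¹ (ρ j) = j := ρ.symm_apply_apply j
  rw [Equiv.Perm.mul_apply, hj]
  exact (hc j).symm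

end Tableaux

/-! ### Young symmetrizers -/

section Symmetrizers

open MonoidAlgebra Equiv

variable {n : ℕ} {lam : YoungDiagram} {h : lam.card = n} {mu : YoungDiagram} {h' : mu.card = n}

theorem of_mul_rowSum {σ : Perm (Fin n)} (hσ : ∀ i, rowOf lam h (σ i) = rowOf lam h i) :
    of ℂ _ σ * rowSum lam h = rowSum lam h := by
  rw [rowSum, Finset.mul_sum]
  refine Finset.sum_bij' (fun τ _ => σ * τ) (fun τ _ => σ⁻¹ * τ) ?_ ?_ ?_ ?_ ?_
  · intro τ hτ
    rw [Finset.mem_filter] at hτ ⊢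
    exact ⟨Finset.mem_univ _, fun i => (hσ (τ i)).trans (hτ.2 i)⟩
  · intro τ hτ
    rw [Finset.mem_filter] at hτ ⊢
    refine ⟨Finset.mem_univ _, fun i => Eq.trans ?_ (hτ.2 i)⟩
    have := hσ (σ⁻¹ (τ i))
    rw [show σ (σ⁻¹ (τ i)) = τ i from σ.apply_symm_apply _] at this
    exact this.symm
  · intro τ _; group
  · intro τ _; group
  · intro τ _; rw [map_mul]

theorem colSum_mul_of {σ : Perm (Fin n)} (hσ : ∀ i, colOf lam h (σ i) = colOf lam h i) :
    colSum lam h * of ℂ _ σ = ((Perm.sign σ : ℤ) : ℂ) • colSum lam h := by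
  rw [colSum, Finset.sum_mul, Finset.smul_sum]
  refine Finset.sum_bij' (fun τ _ => τ * σ) (fun τ _ => τ * σ⁻¹) ?_ ?_ ?_ ?_ ?_
  · intro τ hτ
    rw [Finset.mem_filter] at hτ ⊢
    exact ⟨Finset.mem_univ _, fun i => (hτ.2 (σ i)).trans (hσ i)⟩
  · intro τ hτ
    rw [Finset.mem_filter] at hτ ⊢
    refine ⟨Finset.mem_univ _, fun i => (hτ.2 (σ⁻¹ i)).trans ?_⟩
    have := hσ (σ⁻¹ i)
    rw [show σ (σ⁻¹ i) = i from σ.apply_symm_apply _] at this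
    exact this.symm
  · intro τ _; group
  · intro τ _; group
  · intro τ _
    rw [smul_mul_assoc, ← map_mul, smul_smul, Perm.sign_mul]
    congr 1
    rcases Int.units_eq_one_or (Perm.sign σ) with h1 | h1 <;> simp [h1]

/-- Some transposition within a row is moved by `g` to one within a column. The row sum absorbs it
with sign `1`, the column sum with sign `-1`, so the product equals its negative. -/
theorem colSum_mul_rowSum_eq_zero {g : Perm (Fin n)} (hg : ¬ RowsToColumns h h' g) :
    colSum lam h * of ℂ _ g * rowSum mu h' = 0 := by
  simp only [RowsToColumns, not_forall, not_not] at hg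
  obtain ⟨i, j, hij, hrow, hcol⟩ := hg
  have hr : ∀ x, rowOf mu h' (swap i j x) = rowOf mu h' x := by
    intro x
    rw [swap_apply_def]
    split_ifs with h1 h2
    · rw [h1, hrow]
    · rw [h2, hrow]
    · rfl
  have hc : ∀ x, colOf lam h (swap (g i) (g j) x) = colOf lam h x := by
    intro x
    rw [swap_apply_def]
    split_ifs with h1 h2
    · rw [h1, hcol]
    · rw [h2, hcol]
    · rfl
  have hsw : g * swap i j = swap (g i) (g j) * g := by
    rw [swap_apply_apply]; group
  have h1 : colSum lam h * of ℂ _ g * rowSum mu h' =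
      -(colSum lam h * of ℂ _ g * rowSum mu h') := by
    conv_lhs => rw [← of_mul_rowSum hr, mul_assoc, ← mul_assoc (of ℂ _ g), ← map_mul, hsw,
      map_mul, ← mul_assoc, ← mul_assoc, colSum_mul_of hc,
      Perm.sign_swap (g.injective.ne hij)]
    simp
  have h2 : (2 : ℂ) • (colSum lam h * of ℂ _ g * rowSum mu h') = 0 := by
    rw [two_smul]
    nth_rewrite 1 [h1]
    exact neg_add_cancel _
  exact (smul_eq_zero.1 h2).resolve_left two_ne_zero

/-- A nonzero product `colSum * x * rowSum` implies dominance. -/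
theorem entriesAbove_le_of_ne_zero {x : MonoidAlgebra ℂ (Perm (Fin n))}
    (hx : colSum lam h * x * rowSum mu h' ≠ 0) (k : ℕ) :
    entriesAbove mu h' k ≤ entriesAbove lam h k := by
  by_contra hlt
  refine hx ?_
  clear hx
  have hno : ∀ g, ¬ RowsToColumns h h' g := fun g hg => hlt (hg.entriesAbove_le k)
  induction x using MonoidAlgebra.induction_on with
  | of g => exact colSum_mul_rowSum_eq_zero (hno g)
  | add x y hx hy => rw [mul_add, add_mul, hx, hy, add_zero]
  | smul a x hx => rw [mul_smul_comm, smul_mul_assoc, hx, smul_zero]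

/-- By linearity `x` is a permutation: either it factors as column times row and is absorbed up to
sign, or the product vanishes. -/
theorem exists_colSum_mul_rowSum_eq_smul (x : MonoidAlgebra ℂ (Perm (Fin n))) :
    ∃ a : ℂ, colSum lam h * x * rowSum lam h = a • (colSum lam h * rowSum lam h) := by
  induction x using MonoidAlgebra.induction_on with
  | of g =>
    by_cases hg : RowsToColumns h h g
    · obtain ⟨c, r, rfl, hc, hr⟩ := hg.exists_factorization
      refine ⟨((Perm.sign c : ℤ) : ℂ), ?_⟩
      rw [map_mul, ← mul_assoc, colSum_mul_of hc, mul_assoc, of_mul_rowSum hr, smul_mul_assoc]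
    · exact ⟨0, by rw [colSum_mul_rowSum_eq_zero hg, zero_smul]⟩
  | add x y hx hy =>
    obtain ⟨a, ha⟩ := hx
    obtain ⟨b, hb⟩ := hy
    exact ⟨a + b, by rw [mul_add, add_mul, ha, hb, add_smul]⟩
  | smul b x hx =>
    obtain ⟨a, ha⟩ := hx
    exact ⟨b * a, by rw [mul_smul_comm, smul_mul_assoc, ha, smul_smul]⟩

/-- The coefficient of `1` is `1`: only the identity preserves both rows and columns. -/
theorem colSum_mul_rowSum_ne_zero : colSum lam h * rowSum lam h ≠ 0 := by
  intro h0
  have h1 := congrArg (fun x => x.coeff 1) h0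
  simp only [colSum, rowSum, Finset.sum_mul, Finset.mul_sum, coeff_sum, Finsupp.coe_finsetSum,
    Finset.sum_apply, smul_mul_assoc, coeff_smul_apply, of_apply, single_mul_single, mul_one,
    coeff_single, coeff_zero, Finsupp.coe_zero, Pi.zero_apply] at h1
  rw [Finset.sum_eq_single 1, Finset.sum_eq_single 1] at h1
  · simp at h1
  · intro c _ hc
    rw [mul_one, Finsupp.single_eq_of_ne hc.symm, smul_zero]
  · intro hc
    exact absurd (by simp) hc
  · intro r hr hr1
    refine Finset.sum_eq_zero fun c hc => ?_
    rw [Finset.mem_filter] at hc hr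
    have hcr : c * r ≠ 1 := by
      intro hcr
      refine hr1 (Equiv.ext fun i => eq_of_rowOf_colOf (h := h) (hr.2 i) ?_)
      have h2 := hc.2 (r i)
      rw [show c (r i) = i from congrArg (fun σ : Perm (Fin n) => σ i) hcr] at h2
      exact h2.symm
    rw [Finsupp.single_eq_of_ne hcr.symm, smul_zero]
  · intro hr
    exact absurd (by simp) hr

end Symmetrizers

/-! ### Simplicity of Specht modules -/

section Simplicity

/-- In a semisimple ring a nonzero left ideal has nonzero square. -/
theorem exists_mul_ne_zero {A : Type*} [Ring A] [IsSemisimpleRing A] {N : Submodule A A}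
    (hN : N ≠ ⊥) : ∃ x ∈ N, ∃ y ∈ N, x * y ≠ 0 := by
  by_contra! H
  refine hN ((Submodule.eq_bot_iff N).2 fun y hy => ?_)
  obtain ⟨N', hN'⟩ := exists_isCompl N
  -- Write `1 = f + f'` along a complement `N'`. If `N² = 0`, then `y = y f'` lies in `N ∩ N' = 0`.
  obtain ⟨f, hf, f', hf', hff⟩ := Submodule.mem_sup.1
    (hN'.sup_eq_top ▸ Submodule.mem_top : (1 : A) ∈ N ⊔ N')
  have h1 : y * f' = y := by
    have := congrArg (y * ·) hff
    simpa only [mul_add, mul_one, H y hy f hf, zero_add] using this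
  have h2 : y ∈ N' := h1 ▸ N'.smul_mem y hf'
  exact (Submodule.mem_bot A).1 (hN'.inf_eq_bot ▸ Submodule.mem_inf.2 ⟨hy, h2⟩)

/-- A nonzero `N` inside `A e` has elements with `(a e)(b e) ≠ 0`. Then `e b e` is a nonzero
multiple of `e` and lies in `N`, so `N = A e`. -/
theorem isSimpleModule_span_singleton {k A : Type*} [Field k] [Ring A] [Algebra k A]
    [IsSemisimpleRing A] {e : A} (he : e ≠ 0) (h : ∀ x, ∃ c : k, e * x * e = c • e) :
    IsSimpleModule A (Submodule.span A {e}) := by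
  rw [isSimpleModule_iff_isAtom]
  refine ⟨by simpa using he, fun N hN => ?_⟩
  by_contra hbot
  obtain ⟨x, hx, y, hy, hxy⟩ := exists_mul_ne_zero hbot
  obtain ⟨a, rfl⟩ := Submodule.mem_span_singleton.1 (hN.le hx)
  obtain ⟨b, rfl⟩ := Submodule.mem_span_singleton.1 (hN.le hy)
  obtain ⟨c, hc⟩ := h b
  simp only [smul_eq_mul] at *
  have hc0 : c ≠ 0 := by
    rintro rfl
    refine hxy ?_
    rw [mul_assoc, ← mul_assoc e, hc, zero_smul, mul_zero]
  have hce : c • e ∈ N := by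
    rw [← hc, mul_assoc]
    exact N.smul_mem e hy
  have hmem : e ∈ N := by
    have h1 := N.smul_mem (algebraMap k A c⁻¹) hce
    rwa [smul_eq_mul, ← Algebra.smul_def, inv_smul_smul₀ hc0] at h1
  exact hN.not_ge ((Submodule.span_singleton_le_iff_mem _ _).2 hmem)

open MonoidAlgebra Equiv

variable {n : ℕ} {lam : YoungDiagram} {h : lam.card = n} {mu : YoungDiagram} {h' : mu.card = n}

instance isSimpleModule_specht :
    IsSimpleModule (MonoidAlgebra ℂ (Perm (Fin n))) (specht lam h) := by
  refine isSimpleModule_span_singleton (k := ℂ) colSum_mul_rowSum_ne_zero fun x => ?_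
  obtain ⟨c, hc⟩ := exists_colSum_mul_rowSum_eq_smul (lam := lam) (h := h)
    (rowSum lam h * x * colSum lam h)
  exact ⟨c, by rw [← hc]; simp only [mul_assoc]⟩

/-- The symmetrizer of `lam` acts nontrivially on its own Specht module, hence on that of `mu`; this
yields a nonzero product as in `entriesAbove_le_of_ne_zero`. -/
theorem entriesAbove_le_of_equiv
    (φ : specht lam h ≃ₗ[MonoidAlgebra ℂ (Perm (Fin n))] specht mu h') (k : ℕ) :
    entriesAbove mu h' k ≤ entriesAbove lam h k := by
  obtain ⟨x, hx, y, hy, hxy⟩ := exists_mul_ne_zero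
    ((Submodule.ne_bot_iff _).2 ⟨_, Submodule.mem_span_singleton_self _,
      colSum_mul_rowSum_ne_zero (lam := lam) (h := h)⟩)
  obtain ⟨a, rfl⟩ := Submodule.mem_span_singleton.1 hx
  have h1 : (colSum lam h * rowSum lam h) • (⟨y, hy⟩ : specht lam h) ≠ 0 := by
    intro h0
    refine hxy ?_
    have h2 := congrArg Subtype.val h0
    change colSum lam h * rowSum lam h * y = 0 at h2
    rw [smul_eq_mul, mul_assoc a, h2, mul_zero]
  have h2 := (φ.map_ne_zero_iff).2 h1
  rw [map_smul] at h2
  obtain ⟨b, hb⟩ := Submodule.mem_span_singleton.1 (φ ⟨y, hy⟩).2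
  have h3 : colSum lam h * (rowSum lam h * b * colSum mu h') * rowSum mu h' ≠ 0 := by
    intro h0
    refine h2 (Subtype.ext ?_)
    change colSum lam h * rowSum lam h * (φ ⟨y, hy⟩ : MonoidAlgebra ℂ (Perm (Fin n))) = 0
    rw [← hb, ← h0, smul_eq_mul]
    simp only [mul_assoc]
  exact entriesAbove_le_of_ne_zero h3 k

theorem eq_of_specht_equiv
    (φ : specht lam h ≃ₗ[MonoidAlgebra ℂ (Perm (Fin n))] specht mu h') : lam = mu :=
  eq_of_entriesAbove_eq fun k =>
    le_antisymm (entriesAbove_le_of_equiv φ.symm k) (entriesAbove_le_of_equiv φ k)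

end Simplicity

/-! ### Classification of the simple modules of the symmetric group -/

section Characters

open MonoidAlgebra

variable {G : Type*} [Group G]
  {V : Type*} [AddCommGroup V] [Module ℂ V] [Module (MonoidAlgebra ℂ G) V]
  [IsScalarTower ℂ (MonoidAlgebra ℂ G) V]
  {W : Type*} [AddCommGroup W] [Module ℂ W] [Module (MonoidAlgebra ℂ G) W]
  [IsScalarTower ℂ (MonoidAlgebra ℂ G) W]

/-- The character of a module over a group algebra. -/
def moduleCharacter (V : Type*) [AddCommGroup V] [Module ℂ V] [Module (MonoidAlgebra ℂ G) V]
    [IsScalarTower ℂ (MonoidAlgebra ℂ G) V] : G → ℂ :=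
  (Representation.ofModule' (k := ℂ) (G := G) V).character

theorem ofModule'_apply (g : G) (v : V) :
    Representation.ofModule' (k := ℂ) (G := G) V g v = of ℂ G g • v := rfl

theorem isIrreducible_ofModule' [IsSimpleModule (MonoidAlgebra ℂ G) V] :
    (Representation.ofModule' (k := ℂ) (G := G) V).IsIrreducible := by
  rw [Representation.irreducible_iff_isSimpleModule_asModule]
  obtain ⟨e, -⟩ := nonempty_equiv_of_closure (S := (Set.univ : Set G)) (by simp)
    (Representation.ofModule' (k := ℂ) (G := G) V).asModuleEquiv fun s _ v => by
      rw [Representation.asModuleEquiv_map_smul, of_apply, Representation.asAlgebraHom_single,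
        one_smul, ofModule'_apply, of_apply]
  exact IsSimpleModule.congr e

theorem nonempty_equiv_of_ofModule'
    (h : Nonempty ((Representation.ofModule' (k := ℂ) (G := G) V).Equiv
      (Representation.ofModule' (k := ℂ) (G := G) W))) :
    Nonempty (V ≃ₗ[MonoidAlgebra ℂ G] W) := by
  obtain ⟨φ⟩ := h
  obtain ⟨e, -⟩ := nonempty_equiv_of_closure (S := (Set.univ : Set G)) (by simp) φ.toLinearEquiv
    fun s _ v => Representation.IntertwiningMap.isIntertwining _ _ φ.toIntertwiningMap s v
  exact ⟨e⟩

theorem moduleCharacter_orthogonal [Fintype G]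
    [IsSimpleModule (MonoidAlgebra ℂ G) V] [FiniteDimensional ℂ V]
    [IsSimpleModule (MonoidAlgebra ℂ G) W] [FiniteDimensional ℂ W]
    (h : ¬ Nonempty (V ≃ₗ[MonoidAlgebra ℂ G] W)) :
    (Nat.card G : ℂ)⁻¹ * ∑ g : G, moduleCharacter V g * moduleCharacter W g⁻¹ = 0 := by
  have : Invertible (Nat.card G : ℂ) := invertibleOfNonzero (by simp)
  have := isIrreducible_ofModule' (G := G) (V := V)
  have := isIrreducible_ofModule' (G := G) (V := W)
  refine (Representation.char_orthonormal _ _).trans (if_neg fun he => h ?_)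
  exact (nonempty_equiv_of_ofModule' he).map LinearEquiv.symm

theorem moduleCharacter_orthonormal [Fintype G]
    [IsSimpleModule (MonoidAlgebra ℂ G) V] [FiniteDimensional ℂ V] :
    (Nat.card G : ℂ)⁻¹ * ∑ g : G, moduleCharacter V g * moduleCharacter V g⁻¹ = 1 := by
  have : Invertible (Nat.card G : ℂ) := invertibleOfNonzero (by simp)
  have := isIrreducible_ofModule' (G := G) (V := V)
  refine (Representation.char_orthonormal _ _).trans (if_pos ⟨Representation.Equiv.refl _⟩)

theorem moduleCharacter_eq_of_isConj {g k : G} (h : IsConj g k) :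
    moduleCharacter V g = moduleCharacter V k := by
  obtain ⟨c, rfl⟩ := isConj_iff.1 h
  exact (Representation.char_conj _ g c).symm

/-- Class functions that are orthonormal are at most as many as the conjugacy classes. -/
theorem card_le_card_conjClasses [Fintype G] {ι : Type*} (χ : ι → G → ℂ)
    (hclass : ∀ i g k, IsConj g k → χ i g = χ i k)
    (horth : ∀ i j, i ≠ j → (Nat.card G : ℂ)⁻¹ * ∑ g, χ i g * χ j g⁻¹ = 0)
    (hnorm : ∀ i, (Nat.card G : ℂ)⁻¹ * ∑ g, χ i g * χ i g⁻¹ = 1) :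
    Finite ι ∧ Nat.card ι ≤ Nat.card (ConjClasses G) := by
  classical
  let χ' : ι → ConjClasses G → ℂ := fun i => Quotient.lift (χ i) (hclass i)
  have hχ' : LinearIndependent ℂ χ' := by
    rw [linearIndependent_iff']
    intro s c hc j hj
    have h1 : ∀ g, ∑ i ∈ s, c i * χ i g = 0 := by
      intro g
      have h2 : (∑ i ∈ s, c i • χ' i) (ConjClasses.mk g) = 0 := congrFun hc _
      rwa [Finset.sum_apply] at h2
    -- Pairing the relation with `χ j` extracts its coefficient.
    calc c j = ∑ i ∈ s, c i * ((Nat.card G : ℂ)⁻¹ * ∑ g, χ i g * χ j g⁻¹) := by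
          rw [Finset.sum_eq_single j, hnorm, mul_one]
          · intro i _ hij
            rw [horth i j hij, mul_zero]
          · exact fun h => absurd hj h
      _ = (Nat.card G : ℂ)⁻¹ * ∑ g, (∑ i ∈ s, c i * χ i g) * χ j g⁻¹ := by
          simp only [Finset.mul_sum, Finset.sum_mul]
          rw [Finset.sum_comm]
          refine Finset.sum_congr rfl fun g _ => Finset.sum_congr rfl fun i _ => ?_
          ring
      _ = 0 := by simp [h1]
  have : Finite (ConjClasses G) := Quotient.finite _
  have : Fintype (ConjClasses G) := Fintype.ofFinite _
  have hfin : Finite ι := hχ'.finite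
  have : Fintype ι := Fintype.ofFinite _
  refine ⟨hfin, ?_⟩
  have := hχ'.fintype_card_le_finrank
  rwa [Module.finrank_fintype_fun_eq_card, ← Nat.card_eq_fintype_card,
    ← Nat.card_eq_fintype_card] at this

end Characters

/-! ### Counting Specht modules against conjugacy classes -/

section Classification

open MonoidAlgebra Equiv

variable {n : ℕ}

theorem card_cellsOfRowLens (w : List ℕ) :
    (YoungDiagram.cellsOfRowLens w).card = w.sum := by
  induction w with
  | nil => rfl
  | cons a w ih =>
    rw [YoungDiagram.cellsOfRowLens, Finset.card_union_of_disjoint, Finset.card_map, ih]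
    · simp
    · rw [Finset.disjoint_left]
      rintro ⟨i, j⟩ h1 h2
      simp only [Finset.mem_product, Finset.mem_singleton] at h1
      obtain ⟨⟨k, l⟩, -, h3⟩ := Finset.mem_map.1 h2
      exact Nat.succ_ne_zero k ((congrArg Prod.fst h3).trans h1.1)

/-- The Young diagram of a partition. -/
def diagramOfPartition (p : n.Partition) : {lam : YoungDiagram // lam.card = n} :=
  ⟨YoungDiagram.ofRowLens (p.parts.sort (· ≥ ·)) (Multiset.pairwise_sort _ _).sortedGE, by
    refine (card_cellsOfRowLens _).trans ?_
    rw [← Multiset.sum_coe, Multiset.sort_eq, p.parts_sum]⟩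

theorem diagramOfPartition_injective :
    Function.Injective (diagramOfPartition : n.Partition → _) := by
  intro p q hpq
  have h1 := congrArg (fun l => (l.1.rowLens : Multiset ℕ)) hpq
  simp only [diagramOfPartition] at h1
  rw [YoungDiagram.rowLens_ofRowLens_eq_self, YoungDiagram.rowLens_ofRowLens_eq_self,
    Multiset.sort_eq, Multiset.sort_eq] at h1
  · exact Nat.Partition.ext h1
  · exact fun x hx => q.parts_pos ((Multiset.mem_sort _).1 hx)
  · exact fun x hx => p.parts_pos ((Multiset.mem_sort _).1 hx)

/-- Cycle types separate conjugacy classes. Only this inequality of cardinalities is needed for the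
count. -/
theorem exists_injective_conjClasses :
    ∃ f : ConjClasses (Perm (Fin n)) → {lam : YoungDiagram // lam.card = n},
      Function.Injective f := by
  let c : ConjClasses (Perm (Fin n)) → (Fintype.card (Fin n)).Partition :=
    Quotient.lift Perm.partition fun σ τ h => Perm.partition_eq_of_isConj.1 h
  have hc : Function.Injective c := by
    rintro ⟨σ⟩ ⟨τ⟩ h
    exact Quotient.sound (Perm.partition_eq_of_isConj.2 h)
  -- Cycle types are partitions of `Fintype.card (Fin n)`, so the equality with `n` has to be
  -- transported.
  have : ∀ m, m = n → ∃ f : m.Partition → {lam : YoungDiagram // lam.card = n},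
      Function.Injective f := by
    rintro _ rfl
    exact ⟨_, diagramOfPartition_injective⟩
  obtain ⟨f, hf⟩ := this _ (Fintype.card_fin n)
  exact ⟨f ∘ c, hf.comp hc⟩

instance finiteDimensional_specht (lam : YoungDiagram) (h : lam.card = n) :
    FiniteDimensional ℂ (specht lam h) :=
  inferInstanceAs (FiniteDimensional ℂ ((specht lam h).restrictScalars ℂ))

/-- Every simple module of the symmetric group is a Specht module. -/
theorem exists_equiv_specht (V : Type*) [AddCommGroup V] [Module ℂ V]
    [Module (MonoidAlgebra ℂ (Perm (Fin n))) V]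
    [IsScalarTower ℂ (MonoidAlgebra ℂ (Perm (Fin n))) V]
    [IsSimpleModule (MonoidAlgebra ℂ (Perm (Fin n))) V] [FiniteDimensional ℂ V] :
    ∃ (lam : YoungDiagram) (h : lam.card = n),
      Nonempty (V ≃ₗ[MonoidAlgebra ℂ (Perm (Fin n))] specht lam h) := by
  by_contra! H
  -- The value at `none` is the character of the supposed extra simple module, giving one
  -- orthonormal class function too many.
  let χ : Option {lam : YoungDiagram // lam.card = n} → Perm (Fin n) → ℂ := fun o =>
    o.elim (moduleCharacter V) fun l => moduleCharacter (specht l.1 l.2)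
  obtain ⟨hfin, hle⟩ := card_le_card_conjClasses χ
    (by
      rintro (_ | l) g k hgk
      · exact moduleCharacter_eq_of_isConj hgk
      · exact moduleCharacter_eq_of_isConj hgk)
    (by
      rintro (_ | l) (_ | m) hlm
      · exact absurd rfl hlm
      · exact moduleCharacter_orthogonal (not_nonempty_iff.2 (H m.1 m.2))
      · exact moduleCharacter_orthogonal fun ⟨e⟩ => (H l.1 l.2).elim e.symm
      · refine moduleCharacter_orthogonal fun ⟨e⟩ => hlm ?_
        rw [Subtype.ext (eq_of_specht_equiv e)])
    (by
      rintro (_ | l)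
      · exact moduleCharacter_orthonormal
      · exact moduleCharacter_orthonormal)
  obtain ⟨f, hf⟩ := exists_injective_conjClasses (n := n)
  have hfin' : Finite {lam : YoungDiagram // lam.card = n} :=
    Finite.of_injective _ (Option.some_injective _)
  have h1 := Nat.card_le_card_of_injective f hf
  rw [Finite.card_option] at hle
  omega

end Classification

open MonoidAlgebra Equiv

/-! ### Restriction to the derived subalgebra of `𝔡_n` -/

variable {n : ℕ}

instance finite_B : Finite (B n) := Finite.of_equiv _ SemidirectProduct.equivProd.symm

/-- For `n ≥ 3` the reflections form one class generating `D_n`, so acting by opposite signs would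
make `V` one-dimensional. -/
theorem nonempty_equiv_of_isoDerived_lieD (hn : 2 ≤ n)
    {V : Type*} [AddCommGroup V] [Module ℂ V] [Module (MonoidAlgebra ℂ (D n)) V]
    [IsScalarTower ℂ (MonoidAlgebra ℂ (D n)) V]
    {W : Type*} [AddCommGroup W] [Module ℂ W] [Module (MonoidAlgebra ℂ (D n)) W]
    [IsScalarTower ℂ (MonoidAlgebra ℂ (D n)) W]
    [IsSimpleModule (MonoidAlgebra ℂ (D n)) V] [IsSimpleModule (MonoidAlgebra ℂ (D n)) W]
    (hV : 1 < Module.finrank ℂ V) (hW : 1 < Module.finrank ℂ W)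
    (h : IsoDerived (lieD n) V W) : Nonempty (V ≃ₗ[MonoidAlgebra ℂ (D n)] W) := by
  classical
  have : FiniteDimensional ℂ V := Module.finite_of_finrank_pos (by omega)
  have : FiniteDimensional ℂ W := Module.finite_of_finrank_pos (by omega)
  obtain ⟨f, hf⟩ := (isoDerived_iff _ V W).1 h
  have hinv : ∀ s ∈ reflD n, s * s = 1 := fun s hs => Subtype.ext (mul_self_of_mem_reflSwap hs)
  have hdef : ∀ s ∈ reflD n, ∀ u ∈ reflD n, defect f s = defect f u := by
    rcases hn.eq_or_lt' with h2 | h3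
    · refine absurd (finrank_le_one_of_scalar (closure_reflD (n := n)) fun s hs => ?_) hV.not_ge
      refine exists_scalar_of_commute (closure_reflD (n := n)) s fun u hu v => ?_
      have hsu : s * u = u * s := Subtype.ext (reflSwap_two_commute h2 hs hu)
      rw [← mul_smul, ← mul_smul, ← map_mul, ← map_mul, hsu]
    -- The linking lemmas concern functions on `B n`; the value `0` off `D n` is never used, as
    -- reflections of type `reflSwap` lie in `D n`.
    · let δ : B n → V → W := fun g => if hg : g ∈ D n then defect f (⟨g, hg⟩ : D n) else 0
      have hδval : ∀ s : D n, δ s = defect f s := fun s => dif_pos s.2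
      have hmem : ∀ s ∈ reflSwap n, s ∈ D n := fun s hs =>
        MonoidHom.mem_ker.2 (epsPrime_of_mem_reflSwap hs)
      have hδ : ∀ k ∈ reflSwap n, ∀ s ∈ reflSwap n, δ (k * s * k⁻¹) = δ s := by
        intro k hk s hs
        have h1 := defect_conj f hf (k := ⟨k, hmem k hk⟩) (s := ⟨s, hmem s hs⟩) hk hs
          (hinv _ hk)
        rw [← hδval, ← hδval] at h1
        exact h1
      intro s hs u hu
      rw [← hδval, ← hδval]
      exact reflSwap_value_eq δ hδ (negSwap_value_eq h3 δ hδ) _ hs _ hu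
  rcases commutes_or_opposite_signs f (Set.toFinite (reflD n))
    (fun g s hs => conj_mem_reflSwap (g : B n) s hs) hinv hdef with h1 | ⟨ε, -, h1⟩
  · obtain ⟨e, -⟩ := nonempty_equiv_of_closure (closure_reflD (n := n)) f h1
    exact ⟨e⟩
  · exact absurd (finrank_le_one_of_scalar (closure_reflD (n := n))
      fun s hs => ⟨ε, (h1 s hs).1⟩) hV.not_ge

/-! ### Inflated modules and their twists -/

section Inflation

variable {lam : YoungDiagram} {h : lam.card = n}

theorem asModuleEquiv_of_smul_SLeft (g : B n) (x : SLeft lam h) :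
    (repLeft lam h).asModuleEquiv (of ℂ _ g • x) =
      of ℂ _ g.right • (repLeft lam h).asModuleEquiv x := by
  rw [Representation.asModuleEquiv_map_smul, of_apply, Representation.asAlgebraHom_single,
    one_smul]
  rfl

theorem asModuleEquiv_of_smul_SRight (g : B n) (x : SRight lam h) :
    (repRight lam h).asModuleEquiv (of ℂ _ g • x) =
      ((epsPrime n g : ℤ) : ℂ) • of ℂ _ g.right • (repRight lam h).asModuleEquiv x := by
  rw [Representation.asModuleEquiv_map_smul, of_apply, Representation.asAlgebraHom_single,
    one_smul]
  rfl

variable {V : Type*} [AddCommGroup V] [Module ℂ V] [Module (MonoidAlgebra ℂ (B n)) V]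
    [IsScalarTower ℂ (MonoidAlgebra ℂ (B n)) V]

omit [Module ℂ V] [IsScalarTower ℂ (MonoidAlgebra ℂ (B n)) V] in
/-- If the sign changes act trivially on a module, then the action factors through `S_n`. -/
theorem of_smul_eq_of_perm_smul (ht : ∀ i, ∀ v : V, of ℂ (B n) (t i) • v = v) (g : B n) (v : V) :
    of ℂ (B n) g • v = of ℂ (B n) (perm g.right) • v := by
  have hg : g ∈ Subgroup.closure
      ({g : B n | ∃ i j, i ≠ j ∧ g = perm (swap i j)} ∪ Set.range t) :=
    closure_swap_t ▸ Subgroup.mem_top g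
  induction hg using Subgroup.closure_induction generalizing v with
  | mem g hg =>
    rcases hg with ⟨i, j, -, rfl⟩ | ⟨i, rfl⟩
    · rfl
    · rw [ht]
      have : perm (t i : B n).right = 1 := map_one _
      rw [this, map_one, one_smul]
  | one =>
    have : perm (1 : B n).right = 1 := map_one _
    rw [this]
  | mul a b _ _ ha hb =>
    rw [SemidirectProduct.mul_right, perm_mul, map_mul, map_mul, mul_smul, mul_smul, ha, hb]
  | inv a _ ha =>
    have h1 := ha (of ℂ (B n) (perm a⁻¹.right) • v)
    have h2 : perm a.right * perm a⁻¹.right = 1 := by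
      rw [← perm_mul, SemidirectProduct.inv_right, mul_inv_cancel]
      exact map_one _
    rw [← mul_smul (of ℂ (B n) (perm a.right)), ← map_mul, h2, map_one, one_smul] at h1
    rw [← h1, ← mul_smul, ← map_mul, inv_mul_cancel, map_one, one_smul, h1]

/-- A simple `ℂB_n`-module on which the sign changes act trivially is, as an `S_n`-module, a Specht
module. -/
theorem exists_specht_of_t_trivial [IsSimpleModule (MonoidAlgebra ℂ (B n)) V]
    [FiniteDimensional ℂ V] (ht : ∀ i, ∀ v : V, of ℂ (B n) (t i) • v = v) :
    ∃ (lam : YoungDiagram) (h : lam.card = n) (e : V ≃ₗ[ℂ] specht lam h),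
      ∀ σ v, e (of ℂ (B n) (perm σ) • v) = of ℂ _ σ • e v := by
  let φ : MonoidAlgebra ℂ (Perm (Fin n)) →ₐ[ℂ] MonoidAlgebra ℂ (B n) :=
    MonoidAlgebra.mapDomainAlgHom ℂ ℂ SemidirectProduct.inr
  have hφ : ∀ σ, φ (of ℂ _ σ) = of ℂ (B n) (perm σ) := fun σ => by simp [φ, perm]
  let _ : Module (MonoidAlgebra ℂ (Perm (Fin n))) V := Module.compHom V φ.toRingHom
  have hsmul : ∀ (x : MonoidAlgebra ℂ (Perm (Fin n))) (v : V), x • v = φ x • v := fun _ _ => rfl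
  have : IsScalarTower ℂ (MonoidAlgebra ℂ (Perm (Fin n))) V :=
    ⟨fun c x v => by rw [hsmul, hsmul, map_smul, smul_assoc]⟩
  -- Both algebras act through the same operators, so simplicity passes to `S_n`.
  have hfactor : ∀ x : MonoidAlgebra ℂ (B n), ∃ y : MonoidAlgebra ℂ (Perm (Fin n)),
      ∀ v : V, x • v = y • v := by
    intro x
    induction x using MonoidAlgebra.induction_on with
    | of g =>
      exact ⟨of ℂ _ g.right, fun v => by rw [hsmul, hφ, of_smul_eq_of_perm_smul ht]⟩
    | add x y hx hy =>
      obtain ⟨a, ha⟩ := hx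
      obtain ⟨b, hb⟩ := hy
      exact ⟨a + b, fun v => by rw [add_smul, add_smul, ha, hb]⟩
    | smul c x hx =>
      obtain ⟨a, ha⟩ := hx
      exact ⟨c • a, fun v => by rw [smul_assoc, smul_assoc, ha]⟩
  have : IsSimpleModule (MonoidAlgebra ℂ (Perm (Fin n))) V := by
    rw [isSimpleModule_iff_toSpanSingleton_surjective]
    refine ⟨IsSimpleModule.nontrivial (MonoidAlgebra ℂ (B n)) V, fun v hv w => ?_⟩
    obtain ⟨x, hx⟩ := IsSimpleModule.toSpanSingleton_surjective (MonoidAlgebra ℂ (B n)) hv w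
    obtain ⟨y, hy⟩ := hfactor x
    exact ⟨y, (hy v).symm.trans hx⟩
  obtain ⟨lam, h, ⟨e⟩⟩ := exists_equiv_specht (n := n) V
  refine ⟨lam, h, e.restrictScalars ℂ, fun σ v => ?_⟩
  rw [← hφ, ← hsmul]
  exact e.map_smul _ v

variable {W : Type*} [AddCommGroup W] [Module ℂ W] [Module (MonoidAlgebra ℂ (B n)) W]
    [IsScalarTower ℂ (MonoidAlgebra ℂ (B n)) W]

/-- The Specht structure on `V` is carried to `W` by `f`, which respects the `(i,j)`; the sign of `t
i` on `W` is exactly the twist by `ε'`. -/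
theorem exists_SLeft_SRight [IsSimpleModule (MonoidAlgebra ℂ (B n)) V]
    [FiniteDimensional ℂ V] (f : V ≃ₗ[ℂ] W)
    (hf : ∀ s ∈ reflSwap n, ∀ v, f (of ℂ _ s • v) = of ℂ _ s • f v)
    (htV : ∀ i, ∀ v : V, of ℂ (B n) (t i) • v = v)
    (htW : ∀ i, ∀ w : W, of ℂ (B n) (t i) • w = -w) :
    ∃ (lam : YoungDiagram) (h : lam.card = n),
      Nonempty (V ≃ₗ[MonoidAlgebra ℂ (B n)] SLeft lam h) ∧
        Nonempty (W ≃ₗ[MonoidAlgebra ℂ (B n)] SRight lam h) := by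
  obtain ⟨lam, h, e, he⟩ := exists_specht_of_t_trivial (V := V) htV
  refine ⟨lam, h, ?_, ?_⟩
  · let F : V ≃ₗ[ℂ] SLeft lam h := e.trans (repLeft lam h).asModuleEquiv.symm
    have hF : ∀ v, (repLeft lam h).asModuleEquiv (F v) = e v := fun _ => rfl
    obtain ⟨e', -⟩ := nonempty_equiv_of_closure (V := V) (W := SLeft lam h)
      (closure_swap_t (n := n)) F (by
      intro s hs v
      apply (repLeft lam h).asModuleEquiv.injective
      rw [asModuleEquiv_of_smul_SLeft, hF, hF]
      rcases hs with ⟨i, j, -, rfl⟩ | ⟨i, rfl⟩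
      · exact he _ v
      · rw [htV]
        exact (one_smul (MonoidAlgebra ℂ (Perm (Fin n))) (e v)).symm)
    exact ⟨e'⟩
  · let F : W ≃ₗ[ℂ] SRight lam h := (f.symm.trans e).trans (repRight lam h).asModuleEquiv.symm
    have hF : ∀ w, (repRight lam h).asModuleEquiv (F w) = e (f.symm w) := fun _ => rfl
    obtain ⟨e', -⟩ := nonempty_equiv_of_closure (V := W) (W := SRight lam h)
      (closure_swap_t (n := n)) F (by
      intro s hs w
      apply (repRight lam h).asModuleEquiv.injective
      rw [asModuleEquiv_of_smul_SRight, hF, hF]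
      obtain ⟨v, rfl⟩ := f.surjective w
      rcases hs with ⟨i, j, hij, rfl⟩ | ⟨i, rfl⟩
      · rw [← hf _ (swap_mem_reflSwap hij), f.symm_apply_apply, f.symm_apply_apply, epsPrime_perm,
          Units.val_one, Int.cast_one, one_smul]
        exact he _ v
      · have h1 : of ℂ _ (t i : B n).right • e v = e v :=
          one_smul (MonoidAlgebra ℂ (Perm (Fin n))) (e v)
        rw [htW, map_neg, map_neg, f.symm_apply_apply, epsPrime_t, h1, Units.val_neg,
          Units.val_one, Int.cast_neg, Int.cast_one]
        exact (neg_one_smul ℂ (e v)).symm)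
    exact ⟨e'⟩

end Inflation

/-! ### Restriction to the derived subalgebra of `𝔟_n` -/

section ScalarDefect

attribute [local instance] LieRing.ofAssociativeRing

/-- If a linear isomorphism commutes with generators up to scalars, then it commutes with the
derived subalgebra. -/
theorem isoDerived_of_scalar_defect {G : Type*} [Group G] {S : Set G}
    {V : Type*} [AddCommGroup V] [Module ℂ V] [Module (MonoidAlgebra ℂ G) V]
    [IsScalarTower ℂ (MonoidAlgebra ℂ G) V]
    {W : Type*} [AddCommGroup W] [Module ℂ W] [Module (MonoidAlgebra ℂ G) W]
    [IsScalarTower ℂ (MonoidAlgebra ℂ G) W] (f : V ≃ₗ[ℂ] W)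
    (h : ∀ s ∈ S, ∃ c : ℂ, ∀ v, f (of ℂ G s • v) = of ℂ G s • f v + c • f v) :
    IsoDerived (lieGen S) V W := by
  -- Scalar defects are central and cancel in a commutator, so a bracket has defect `0`.
  have bracket : ∀ x y : MonoidAlgebra ℂ G,
      (∃ c : ℂ, ∀ v, f (x • v) = x • f v + c • f v) →
      (∃ c : ℂ, ∀ v, f (y • v) = y • f v + c • f v) →
      ∀ v, f ((x * y - y * x) • v) = (x * y - y * x) • f v := by
    rintro x y ⟨c, hc⟩ ⟨d, hd⟩ v
    simp only [sub_smul, mul_smul, map_sub, hc, hd, smul_add]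
    rw [smul_comm x d, smul_comm y c, smul_comm c d]
    abel
  have hall : ∀ x ∈ lieGen S, ∃ c : ℂ, ∀ v, f (x • v) = x • f v + c • f v := by
    intro x hx
    induction hx using LieSubalgebra.lieSpan_induction with
    | mem x hx =>
      obtain ⟨s, hs, rfl⟩ := hx
      exact h s hs
    | zero => exact ⟨0, by simp⟩
    | add x y _ _ hx hy =>
      obtain ⟨c, hc⟩ := hx
      obtain ⟨d, hd⟩ := hy
      refine ⟨c + d, fun v => ?_⟩
      rw [add_smul, map_add, hc, hd, add_smul, add_smul]
      abel
    | smul a x _ hx =>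
      obtain ⟨c, hc⟩ := hx
      exact ⟨a * c, fun v => by rw [smul_assoc, map_smul, hc, smul_add, smul_assoc, mul_smul]⟩
    | lie x y _ _ hx hy =>
      exact ⟨0, fun v => by rw [zero_smul, add_zero]; exact bracket x y hx hy v⟩
  exact (isoDerived_iff _ V W).2 ⟨f, fun x hx y hy => bracket x y (hall x hx) (hall y hy)⟩

end ScalarDefect

variable {V : Type*} [AddCommGroup V] [Module ℂ V] [Module (MonoidAlgebra ℂ (B n)) V]
  [IsScalarTower ℂ (MonoidAlgebra ℂ (B n)) V]
  {W : Type*} [AddCommGroup W] [Module ℂ W] [Module (MonoidAlgebra ℂ (B n)) W]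
  [IsScalarTower ℂ (MonoidAlgebra ℂ (B n)) W]

/-- Both modules live on the same Specht space, and its identity map has scalar defect on every
reflection. -/
theorem isoDerived_lieB_of_SLeft_SRight {lam : YoungDiagram} {h : lam.card = n}
    (e₁ : V ≃ₗ[MonoidAlgebra ℂ (B n)] SLeft lam h)
    (e₂ : W ≃ₗ[MonoidAlgebra ℂ (B n)] SRight lam h) : IsoDerived (lieB n) V W := by
  let f₁ : V ≃ₗ[ℂ] specht lam h := (e₁.restrictScalars ℂ).trans (repLeft lam h).asModuleEquiv
  let f₂ : W ≃ₗ[ℂ] specht lam h := (e₂.restrictScalars ℂ).trans (repRight lam h).asModuleEquiv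
  have h₁ : ∀ (g : B n) v, f₁ (of ℂ _ g • v) = of ℂ _ g.right • f₁ v := fun g v => by
    change (repLeft lam h).asModuleEquiv (e₁ (of ℂ _ g • v)) = _
    rw [map_smul, asModuleEquiv_of_smul_SLeft]
    rfl
  have h₂ : ∀ (g : B n) w, f₂ (of ℂ _ g • w) =
      ((epsPrime n g : ℤ) : ℂ) • of ℂ _ g.right • f₂ w := fun g w => by
    change (repRight lam h).asModuleEquiv (e₂ (of ℂ _ g • w)) = _
    rw [map_smul, asModuleEquiv_of_smul_SRight]
    rfl
  refine isoDerived_of_scalar_defect (S := reflB n) (f₁.trans f₂.symm) ?_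
  rintro s (hs | ⟨i, rfl⟩)
  · refine ⟨0, fun v => f₂.injective ?_⟩
    rw [zero_smul, add_zero, h₂, epsPrime_of_mem_reflSwap hs]
    simp only [LinearEquiv.trans_apply, LinearEquiv.apply_symm_apply, h₁]
    simp
  -- `t i` acts as `1` on the source and `-1` on the target; the difference is `2`.
  · refine ⟨2, fun v => f₂.injective ?_⟩
    have h1 : ∀ x : specht lam h, of ℂ _ (t i : B n).right • x = x :=
      fun x => one_smul (MonoidAlgebra ℂ (Perm (Fin n))) x
    rw [map_add, f₂.map_smul, h₂, epsPrime_t]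
    simp only [LinearEquiv.trans_apply, LinearEquiv.apply_symm_apply, h₁, h1]
    simp only [Units.val_neg, Units.val_one, Int.cast_neg, Int.cast_one]
    module

/-- If the reflections `(i,j)` act on a simple `ℂB_n`-module by a common scalar, then the module is
one-dimensional. -/
theorem finrank_le_one_of_reflSwap_scalar [IsSimpleModule (MonoidAlgebra ℂ (B n)) V]
    [FiniteDimensional ℂ V] {ε : ℂ}
    (h : ∀ s ∈ reflSwap n, ∀ v : V, of ℂ (B n) s • v = ε • v) : Module.finrank ℂ V ≤ 1 := by
  -- Once the other reflections are scalars, each `t i` commutes with all generators and is itself a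
  -- scalar by Schur's lemma.
  have hcomm : ∀ i, ∀ s ∈ reflB n, ∀ v : V,
      of ℂ (B n) (t i) • of ℂ (B n) s • v = of ℂ (B n) s • of ℂ (B n) (t i) • v := by
    rintro i s (hs | ⟨j, rfl⟩) v
    · rw [h s hs, h s hs, smul_comm]
    · rw [← mul_smul, ← mul_smul, ← map_mul, ← map_mul, t_mul_t_comm]
  refine finrank_le_one_of_scalar (closure_reflB (n := n)) ?_
  rintro s (hs | ⟨i, rfl⟩)
  · exact ⟨ε, h s hs⟩
  · exact exists_scalar_of_commute (closure_reflB (n := n)) (t i) (hcomm i)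

theorem nonempty_equiv_or_of_isoDerived_lieB
    [IsSimpleModule (MonoidAlgebra ℂ (B n)) V] [IsSimpleModule (MonoidAlgebra ℂ (B n)) W]
    (hV : 1 < Module.finrank ℂ V) (hW : 1 < Module.finrank ℂ W)
    (h : IsoDerived (lieB n) V W) :
    Nonempty (V ≃ₗ[MonoidAlgebra ℂ (B n)] W) ∨
      ∃ (lam : YoungDiagram) (h : lam.card = n),
        (Nonempty (V ≃ₗ[MonoidAlgebra ℂ (B n)] SLeft lam h) ∧
          Nonempty (W ≃ₗ[MonoidAlgebra ℂ (B n)] SRight lam h)) ∨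
        (Nonempty (W ≃ₗ[MonoidAlgebra ℂ (B n)] SLeft lam h) ∧
          Nonempty (V ≃ₗ[MonoidAlgebra ℂ (B n)] SRight lam h)) := by
  have : FiniteDimensional ℂ V := Module.finite_of_finrank_pos (by omega)
  have : FiniteDimensional ℂ W := Module.finite_of_finrank_pos (by omega)
  obtain ⟨f, hf⟩ := (isoDerived_iff _ V W).1 h
  have hδ : ∀ k ∈ reflB n, ∀ s ∈ reflB n, k * k = 1 → defect f (k * s * k⁻¹) = defect f s :=
    fun k hk s hs hkk => defect_conj f hf hk hs hkk
  have hswap : ∀ s ∈ reflSwap n, ∀ v, f (of ℂ _ s • v) = of ℂ _ s • f v := by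
    rcases commutes_or_opposite_signs f (Set.toFinite (reflSwap n)) conj_mem_reflSwap
      (fun s hs => mul_self_of_mem_reflSwap hs)
      (reflSwap_value_eq (defect f)
        (fun k hk s hs => hδ k (Or.inl hk) s (Or.inl hs) (mul_self_of_mem_reflSwap hk))
        fun i j hij => by
          -- Conjugation by `t i` is available in `𝔟_n`, so no third index is needed and `n = 2` is
          -- included.
          rw [← t_conj_swap_left]
          exact hδ _ (Or.inr ⟨i, rfl⟩) _ (Or.inl (swap_mem_reflSwap hij)) (t_mul_self i))
      with h1 | ⟨ε, -, h1⟩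
    · exact h1
    · exact absurd (finrank_le_one_of_reflSwap_scalar fun s hs => (h1 s hs).1) hV.not_ge
  have htdef : ∀ s ∈ Set.range (t (n := n)), ∀ u ∈ Set.range (t (n := n)),
      defect f s = defect f u := by
    rintro _ ⟨i, rfl⟩ _ ⟨j, rfl⟩
    by_cases hij : i = j
    · rw [hij]
    · have h1 := hδ _ (Or.inl (swap_mem_reflSwap hij)) (t i) (Or.inr ⟨i, rfl⟩)
        (swap_perm_mul_self i j)
      rw [perm_conj_t, swap_apply_left] at h1
      exact h1.symm
  -- The three cases: `f` is `B_n`-linear; `t i` is `1` on `V` and `-1` on `W`; or the reverse,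
  -- handled with `f.symm`.
  rcases commutes_or_opposite_signs f (Set.toFinite (Set.range t)) conj_mem_range_t
    (by rintro _ ⟨i, rfl⟩; exact t_mul_self i) htdef with h1 | ⟨ε, rfl | rfl, h1⟩
  · left
    obtain ⟨e, -⟩ := nonempty_equiv_of_closure (closure_reflB (n := n)) f (by
      rintro s (hs | hs)
      · exact hswap s hs
      · exact h1 s hs)
    exact ⟨e⟩
  · right
    obtain ⟨lam, h, H⟩ := exists_SLeft_SRight f hswap
      (fun i v => by rw [(h1 _ ⟨i, rfl⟩).1, one_smul])
      (fun i w => by rw [(h1 _ ⟨i, rfl⟩).2, neg_one_smul])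
    exact ⟨lam, h, Or.inl H⟩
  · right
    obtain ⟨lam, h, H⟩ := exists_SLeft_SRight f.symm
      (fun s hs w => by
        obtain ⟨v, rfl⟩ := f.surjective w
        rw [← hswap s hs, f.symm_apply_apply, f.symm_apply_apply])
      (fun i w => by rw [(h1 _ ⟨i, rfl⟩).2, neg_neg, one_smul])
      (fun i v => by rw [(h1 _ ⟨i, rfl⟩).1, neg_one_smul])
    exact ⟨lam, h, Or.inr H⟩

theorem isoDerived_lieB_iff
    [IsSimpleModule (MonoidAlgebra ℂ (B n)) V] [IsSimpleModule (MonoidAlgebra ℂ (B n)) W]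
    (hV : 1 < Module.finrank ℂ V) (hW : 1 < Module.finrank ℂ W) :
    IsoDerived (lieB n) V W ↔ Nonempty (V ≃ₗ[MonoidAlgebra ℂ (B n)] W) ∨
      ∃ (lam : YoungDiagram) (h : lam.card = n),
        (Nonempty (V ≃ₗ[MonoidAlgebra ℂ (B n)] SLeft lam h) ∧
          Nonempty (W ≃ₗ[MonoidAlgebra ℂ (B n)] SRight lam h)) ∨
        (Nonempty (W ≃ₗ[MonoidAlgebra ℂ (B n)] SLeft lam h) ∧
          Nonempty (V ≃ₗ[MonoidAlgebra ℂ (B n)] SRight lam h)) := by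
  refine ⟨nonempty_equiv_or_of_isoDerived_lieB hV hW, ?_⟩
  rintro (h | ⟨lam, h, ⟨⟨e₁⟩, ⟨e₂⟩⟩ | ⟨⟨e₁⟩, ⟨e₂⟩⟩⟩)
  · exact IsoLie.isoDerived _ V W ((nonempty_equiv_iff_isoLie (closure_reflB (n := n))).1 h)
  · exact isoDerived_lieB_of_SLeft_SRight e₁ e₂
  · exact IsoDerived.symm _ W V (isoDerived_lieB_of_SLeft_SRight e₁ e₂)

end WeylRefl

end

/-! ### Comparison of the three notions of isomorphism -/

open WeylRefl in
theorem proposition4p8 (n : ℕ) (hn : 2 ≤ n) :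
    (∀ (V₁ : Type*) [AddCommGroup V₁] [Module ℂ V₁] [Module (MonoidAlgebra ℂ (B n)) V₁]
       [IsScalarTower ℂ (MonoidAlgebra ℂ (B n)) V₁]
       (V₂ : Type*) [AddCommGroup V₂] [Module ℂ V₂] [Module (MonoidAlgebra ℂ (B n)) V₂]
       [IsScalarTower ℂ (MonoidAlgebra ℂ (B n)) V₂],
       IsSimpleModule (MonoidAlgebra ℂ (B n)) V₁ → IsSimpleModule (MonoidAlgebra ℂ (B n)) V₂ →
       1 < Module.finrank ℂ V₁ → 1 < Module.finrank ℂ V₂ →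
        (Nonempty (V₁ ≃ₗ[MonoidAlgebra ℂ (B n)] V₂) ↔ IsoLie (lieB n) V₁ V₂) ∧
        (IsoLie (lieB n) V₁ V₂ → IsoDerived (lieB n) V₁ V₂) ∧
        (IsoDerived (lieB n) V₁ V₂ ↔
          Nonempty (V₁ ≃ₗ[MonoidAlgebra ℂ (B n)] V₂) ∨
          ∃ (lam : YoungDiagram) (h : lam.card = n),
            (Nonempty (V₁ ≃ₗ[MonoidAlgebra ℂ (B n)] SLeft lam h) ∧
              Nonempty (V₂ ≃ₗ[MonoidAlgebra ℂ (B n)] SRight lam h)) ∨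
            (Nonempty (V₂ ≃ₗ[MonoidAlgebra ℂ (B n)] SLeft lam h) ∧
              Nonempty (V₁ ≃ₗ[MonoidAlgebra ℂ (B n)] SRight lam h)))) ∧
    (∀ (V₁ : Type*) [AddCommGroup V₁] [Module ℂ V₁] [Module (MonoidAlgebra ℂ (D n)) V₁]
       [IsScalarTower ℂ (MonoidAlgebra ℂ (D n)) V₁]
       (V₂ : Type*) [AddCommGroup V₂] [Module ℂ V₂] [Module (MonoidAlgebra ℂ (D n)) V₂]
       [IsScalarTower ℂ (MonoidAlgebra ℂ (D n)) V₂],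
       IsSimpleModule (MonoidAlgebra ℂ (D n)) V₁ → IsSimpleModule (MonoidAlgebra ℂ (D n)) V₂ →
       1 < Module.finrank ℂ V₁ → 1 < Module.finrank ℂ V₂ →
        (Nonempty (V₁ ≃ₗ[MonoidAlgebra ℂ (D n)] V₂) ↔ IsoLie (lieD n) V₁ V₂) ∧
        (IsoLie (lieD n) V₁ V₂ → IsoDerived (lieD n) V₁ V₂) ∧
        (IsoDerived (lieD n) V₁ V₂ → Nonempty (V₁ ≃ₗ[MonoidAlgebra ℂ (D n)] V₂))) := by
  refine ⟨?_, ?_⟩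
  · intro V₁ _ _ _ _ V₂ _ _ _ _ hs₁ hs₂ h₁ h₂
    exact ⟨nonempty_equiv_iff_isoLie closure_reflB, IsoLie.isoDerived _ V₁ V₂,
      isoDerived_lieB_iff h₁ h₂⟩
  · intro V₁ _ _ _ _ V₂ _ _ _ _ hs₁ hs₂ h₁ h₂
    exact ⟨nonempty_equiv_iff_isoLie closure_reflD, IsoLie.isoDerived _ V₁ V₂,
      nonempty_equiv_of_isoDerived_lieD hn h₁ h₂⟩
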